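/- For positive integers $n,k$ put $H_n=\sum_{j=1}^n \frac1j$, $\zeta_n(k)=\sum_{j=1}^n\frac1{j^k}$ and $L_n(k)=\sum_{j=1}^n\frac{(-1)^{j-1}}{j^k}$. Let $\zeta(s)=\sum_{n\ge1}\frac1{n^s}$ for integers $s\ge2$, and $\bar\zeta(s)=\sum_{n\ge1}\frac{(-1)^{n-1}}{n^s}$ for integers $s\ge1$ (so the series is conditionally convergent for $s=1$). For integers $q\ge2$ and $r\ge1$ let \[ \zeta^\star(\bar q,r)=\sum_{m\ge1}\frac{(-1)^m}{m^q}\sum_{k=1}^m\frac1{k^r},\qquad \zeta^\star(q,\bar r)=\sum_{m\ge1}\frac1{m^q}\sum_{k=1}^m\frac{(-1)^k}{k^r},\qquad \zeta^\star(\bar q,\bar r)=\sum_{m\ge1}\frac{(-1)^m}{m^q}\sum_{k=1}^m\frac{(-1)^k}{k^r}, \] and let $\zeta^\star(q,r)$ be the same double series without signs. For every integer $p\ge1$ the two series on the left-hand side below converge absolutely, as do the series for $\zeta^\star$ with $q\ge2$, $r\ge1$; the series for $\bar\zeta(s)$, $s\ge1$, converges; and \begin{align*} &\frac32\sum_{n=1}^\infty\frac{L_n(1)^2}{n^{p+1}}(-1)^{n-1}-\bigl(1+(-1)^{p-1}\bigr)\sum_{n=1}^\infty\frac{H_n^2}{n^{p+1}}(-1)^{n-1}\\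 &=\ln2\,\bigl(\zeta^\star(\overline{p+1},\bar1)-\zeta^\star(\overline{p+1},1)\bigr)+\tfrac12\zeta(2)\bigl\{\zeta(p+1)+\bar\zeta(p+1)\bigr\}+\tfrac12\zeta^\star(\overline{p+1},2)\\ &\quad-\sum_{j=2}^{p}\bigl(1-(-1)^{j-1}\bigr)\zeta^\star(\bar j,1)\,\zeta(p+2-j)-\sum_{j=2}^{p+1}\zeta^\star(j,\bar1)\,\bar\zeta(p+2-j)\\ &\quad+\bigl(p+2+(-1)^{p-1}\bigr)\zeta^\star(\overline{p+2},1)-\zeta^\star(p+2,\bar1)-\sum_{i=1}^{p-1}(-1)^{i-1}\zeta(p+1-i)\,\bar\zeta(i+2)\\ &\quad-(p+1)\,\zeta^\star(\overline{p+2},\bar1)+\ln2\;\zeta^\star(\overline{p+1},\bar1), \end{align*} where empty sums are $0$. -/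

import Mathlib

namespace EulerSum

noncomputable section

/-- The generalized harmonic number `ζ_n(k) = ∑_{j=1}^n 1 / j ^ k`. -/
def zetaN (k n : ℕ) : ℝ := ∑ j ∈ Finset.Icc 1 n, 1 / (j : ℝ) ^ k

/-- The harmonic number `H_n = ∑_{j=1}^n 1 / j`. -/
def H (n : ℕ) : ℝ := zetaN 1 n

/-- The alternating harmonic number `L_n(k) = ∑_{j=1}^n (-1)^(j-1) / j ^ k`. -/
def L (k n : ℕ) : ℝ := ∑ j ∈ Finset.Icc 1 n, (-1 : ℝ) ^ (j - 1) / (j : ℝ) ^ k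

/-- The zeta value `ζ(s) = ∑_{n ≥ 1} 1 / n ^ s` at an integer `s ≥ 2`
(the index is shifted: the `n`-th term of the Lean series is the term at `n + 1`). -/
def zeta (s : ℕ) : ℝ := ∑' n : ℕ, 1 / ((n : ℝ) + 1) ^ s

/-- The terms of the alternating zeta series: the `n`-th one is `(-1)^n / (n+1)^s`. -/
def zetaBarTerm (s n : ℕ) : ℝ := (-1 : ℝ) ^ n / ((n : ℝ) + 1) ^ s

/-- The alternating zeta value `∑_{n ≥ 1} (-1)^(n-1) / n ^ s` at an integer `s ≥ 1`. The series is
summed in its natural order, as a limit of partial sums, since it converges only conditionally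
at `s = 1`. -/
def zetaBar (s : ℕ) : ℝ := ∑'[SummationFilter.conditional ℕ] n, zetaBarTerm s n

/-- The terms of the double zeta-star series with signs `ε₁`, `ε₂`: the `n`-th one is
`ε₁ ^ m / m ^ q * ∑_{k=1}^m ε₂ ^ k / k ^ r` at `m = n + 1`. -/
def zetaStarTerm (ε₁ ε₂ : ℝ) (q r n : ℕ) : ℝ :=
  ε₁ ^ (n + 1) / ((n : ℝ) + 1) ^ q * ∑ k ∈ Finset.Icc 1 (n + 1), ε₂ ^ k / (k : ℝ) ^ r

/-- The double zeta-star value `∑_{m ≥ k ≥ 1} ε₁ ^ m ε₂ ^ k / (m ^ q k ^ r)`, for `q ≥ 2`, `r ≥ 1`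
and signs `ε₁`, `ε₂` in `{1, -1}`: a sign `-1` is a bar over the corresponding argument, so that
`zetaStar (-1) 1 q r` is `ζ⋆(q̄, r)` and `zetaStar 1 (-1) q r` is `ζ⋆(q, r̄)`. -/
def zetaStar (ε₁ ε₂ : ℝ) (q r : ℕ) : ℝ := ∑' n : ℕ, zetaStarTerm ε₁ ε₂ q r n

/-- The terms of `∑_{n ≥ 1} H_n ^ 2 (-1)^(n-1) / n ^ q`, shifted to start at `n = 0`. -/
def altHSqTerm (q n : ℕ) : ℝ := H (n + 1) ^ 2 / ((n : ℝ) + 1) ^ q * (-1) ^ n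

/-- The terms of `∑_{n ≥ 1} L_n(1) ^ 2 (-1)^(n-1) / n ^ q`, shifted to start at `n = 0`. -/
def altLSqTerm (q n : ℕ) : ℝ := L 1 (n + 1) ^ 2 / ((n : ℝ) + 1) ^ q * (-1) ^ n

/-- `zeta` agrees with Mathlib's Riemann zeta function at the integers `s ≥ 2`. -/
theorem riemannZeta_eq_zeta {s : ℕ} (hs : 2 ≤ s) : riemannZeta (s : ℂ) = (zeta s : ℂ) := by
  rw [zeta_eq_tsum_one_div_nat_add_one_cpow (by simp; omega), zeta, Complex.ofReal_tsum]
  simp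

end

end EulerSum

namespace EulerSum

open Filter Topology

/-! ### Harmonic numbers -/

/-! The relation is the sum of three evaluations of products of single series, in which the
quadratic sums appear by partial fractions. For `a ≠ b` the finite geometric sum of `1 / (a ^ j b ^
(p + 2 - j))` over `2 ≤ j ≤ p` leaves only the kernels `1 / (a (a - b))` and `1 / (b (a - b))`,
weighted by `1 / b ^ p` and `1 / a ^ p`; the diagonal adds `p - 1` equal terms. Inserting `(-1) ^ j`
changes `a - b` into `a + b`. Summed against `c a * e b`, this gives `sum_mul_tsum_sub` and
`sum_mul_tsum_add`, whose inner sums over one index have closed forms in harmonic numbers.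

The choice `c = L 1`, `e = (-1) ^ b` in the difference form gives the sum of `L 1 ^ 2` with
coefficient 1/2 from one inner sum and 1 from the other, hence 3/2. The choice `c = (-1) ^ a * H a`,
`e = 1` in both forms, added, gives the sum of `H ^ 2`. The choice `c = (-1) ^ a / a`, `e = 1` in
the sum form gives the products of `zeta` and `zetaBar`. On addition the terms with `log 2 * (zeta
(p + 2) + zetaBar (p + 2))` and `zetaStar (-1) (-1) (p + 1) 2` cancel.

Exchanging the two summations requires absolute convergence of the double series, which is
`summable_triple`. The convention `1 / 0 = 0` removes the index 0 and the poles `a = b` from all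
sums. -/

theorem zetaN_zero (k : ℕ) : zetaN k 0 = 0 := by simp [zetaN]

theorem L_zero (k : ℕ) : L k 0 = 0 := by simp [L]

theorem H_zero : H 0 = 0 := zetaN_zero 1

theorem zetaN_succ (k n : ℕ) : zetaN k (n + 1) = zetaN k n + 1 / ((n : ℝ) + 1) ^ k := by
  simp [zetaN, Finset.sum_Icc_succ_top]

theorem H_succ (n : ℕ) : H (n + 1) = H n + 1 / ((n : ℝ) + 1) := by
  simp [H, zetaN_succ]

theorem L_succ (k n : ℕ) : L k (n + 1) = L k n + (-1) ^ n / ((n : ℝ) + 1) ^ k := by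
  simp [L, Finset.sum_Icc_succ_top]

theorem H_nonneg (n : ℕ) : 0 ≤ H n := by
  unfold H zetaN
  positivity

theorem H_eq_harmonic (n : ℕ) : H n = (harmonic n : ℝ) := by
  induction n with
  | zero => simp [H_zero]
  | succ n ih => rw [H_succ, ih, harmonic_succ]; push_cast; simp

theorem H_le_rpow (n : ℕ) : H n ≤ 5 * (n : ℝ) ^ (1 / 4 : ℝ) := by
  rcases Nat.eq_zero_or_pos n with rfl | hn
  · simp [H_zero]
  have h1 : (1 : ℝ) ≤ n := by exact_mod_cast hn
  -- With exponent 1/4, `log n ≤ 4 n ^ (1 / 4)`; the 1 in `1 + log n` is at most `n ^ (1 / 4)`,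
  -- whence the constant 5.
  have h2 := Real.log_le_rpow_div (x := (n : ℝ)) (by linarith) (ε := 1 / 4) (by norm_num)
  have h3 := Real.one_le_rpow h1 (z := 1 / 4) (by norm_num)
  have h4 := harmonic_le_one_add_log n
  rw [H_eq_harmonic]
  linarith

theorem abs_sum_div_pow_le_H {u : ℕ → ℝ} (hu : ∀ k, |u k| ≤ 1) {r : ℕ} (hr : 1 ≤ r) (n : ℕ) :
    |∑ k ∈ Finset.Icc 1 n, u k / (k : ℝ) ^ r| ≤ H n := by
  refine (Finset.abs_sum_le_sum_abs _ _).trans (Finset.sum_le_sum fun k hk => ?_)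
  have hk1 : (1 : ℝ) ≤ k := by exact_mod_cast (Finset.mem_Icc.1 hk).1
  rw [abs_div, abs_of_nonneg (by positivity : (0 : ℝ) ≤ (k : ℝ) ^ r)]
  have : (k : ℝ) ^ 1 ≤ (k : ℝ) ^ r := pow_le_pow_right₀ hk1 hr
  gcongr
  · exact hu k

theorem abs_neg_one_pow_le (n : ℕ) : |(-1 : ℝ) ^ n| ≤ 1 := by simp

theorem neg_one_pow_mul_self (n : ℕ) : (-1 : ℝ) ^ n * (-1) ^ n = 1 := by
  rw [← mul_pow]; simp

theorem abs_L_le {r : ℕ} (hr : 1 ≤ r) (n : ℕ) : |L r n| ≤ H n :=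
  abs_sum_div_pow_le_H (fun k => abs_neg_one_pow_le (k - 1)) hr n

theorem tendsto_shift_inv (a : ℕ) : Tendsto (fun n : ℕ => 1 / ((n : ℝ) + a + 1)) atTop (𝓝 0) := by
  have := (tendsto_add_atTop_iff_nat a).2 (tendsto_one_div_add_atTop_nhds_zero_nat (𝕜 := ℝ))
  simpa using this

theorem tendsto_H_shift_sub (a : ℕ) : Tendsto (fun n => H (n + a) - H n) atTop (𝓝 0) := by
  induction a with
  | zero => simp
  | succ a ih =>
    have := ih.add (tendsto_shift_inv a)
    rw [add_zero] at this
    refine this.congr fun n => ?_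
    rw [← add_assoc, H_succ]; push_cast; ring

theorem L_one_two_mul (n : ℕ) : L 1 (2 * n) = H (2 * n) - H n := by
  induction n with
  | zero => simp [L_zero, H_zero]
  | succ n ih =>
    rw [show 2 * (n + 1) = 2 * n + 1 + 1 by ring, L_succ, L_succ, H_succ, H_succ, H_succ, ih]
    have h1 : (n : ℝ) + 1 ≠ 0 := by positivity
    have h2 : (2 * n : ℝ) + 1 ≠ 0 := by positivity
    have h3 : (2 * n : ℝ) + 1 + 1 ≠ 0 := by positivity
    have h4 : (-1 : ℝ) ^ (2 * n) = 1 := by rw [pow_mul]; simp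
    rw [pow_succ (-1 : ℝ), h4]
    push_cast
    field_simp
    ring

/-- The alternating series test gives a limit; along even indices `L 1 (2 n) = H (2 n) - H n`, where
the Euler constant cancels and `log 2` remains. -/
theorem tendsto_L_one : Tendsto (L 1) atTop (𝓝 (Real.log 2)) := by
  have h2 : Tendsto (fun n : ℕ => 2 * n) atTop atTop :=
    tendsto_id.const_mul_atTop' (by norm_num)
  have hg := Real.tendsto_harmonic_sub_log
  have he : Tendsto (fun n => L 1 (2 * n)) atTop (𝓝 (Real.log 2)) := by
    have := ((hg.comp h2).sub hg).add_const (Real.log 2)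
    rw [sub_self, zero_add] at this
    refine this.congr' ?_
    filter_upwards [eventually_gt_atTop 0] with n hn
    have hn' : (n : ℝ) ≠ 0 := by positivity
    simp only [Function.comp, L_one_two_mul, H_eq_harmonic]
    push_cast
    rw [Real.log_mul (by norm_num) hn']
    ring
  obtain ⟨l, hl⟩ : ∃ l, Tendsto (L 1) atTop (𝓝 l) := by
    obtain ⟨l, hl⟩ := Antitone.tendsto_alternating_series_of_tendsto_zero
      (f := fun n : ℕ => 1 / ((n : ℝ) + 1)) (fun a b hab => by
        have : (a : ℝ) ≤ b := by exact_mod_cast hab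
        dsimp only; gcongr) tendsto_one_div_add_atTop_nhds_zero_nat
    refine ⟨l, hl.congr fun n => ?_⟩
    induction n with
    | zero => simp [L_zero]
    | succ n ih => rw [Finset.sum_range_succ, ih, L_succ]; simp [div_eq_mul_inv]
  rwa [tendsto_nhds_unique (hl.comp h2) he] at hl

theorem tendsto_rpow_quarter_div : Tendsto (fun n : ℕ => (n : ℝ) ^ (1 / 4 : ℝ) / n) atTop (𝓝 0) := by
  have h := (tendsto_rpow_neg_atTop (y := 3 / 4) (by norm_num)).comp
    (tendsto_natCast_atTop_atTop (R := ℝ))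
  refine h.congr' ?_
  filter_upwards [eventually_gt_atTop 0] with n hn
  have hn' : (0 : ℝ) < n := by exact_mod_cast hn
  simp only [Function.comp]
  rw [← Real.rpow_sub_one hn'.ne']
  norm_num

theorem tendsto_H_div : Tendsto (fun n : ℕ => H n / n) atTop (𝓝 0) := by
  have h := tendsto_rpow_quarter_div.const_mul 5
  rw [mul_zero] at h
  refine squeeze_zero (fun n => by have := H_nonneg n; positivity) (fun n => ?_) h
  rw [← mul_div_assoc]
  gcongr
  exact H_le_rpow n

/-! ### Absolute summability of the double series -/

/-- Sequences bounded by a multiple of `n ^ (1 / 4)`. -/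
def SlowGrowth (c : ℕ → ℝ) : Prop := ∃ C, ∀ n, |c n| ≤ C * (n : ℝ) ^ (1 / 4 : ℝ)

theorem SlowGrowth.of_abs_le_H {c : ℕ → ℝ} (h : ∀ n, |c n| ≤ H n) : SlowGrowth c :=
  ⟨5, fun n => (h n).trans (H_le_rpow n)⟩

theorem SlowGrowth.H : SlowGrowth H := .of_abs_le_H fun n => (abs_of_nonneg (H_nonneg n)).le

theorem SlowGrowth.L {r : ℕ} (hr : 1 ≤ r) : SlowGrowth (L r) := .of_abs_le_H (abs_L_le hr)

theorem SlowGrowth.bounded_mul {e c : ℕ → ℝ} (he : ∀ n, |e n| ≤ 1) (hc : SlowGrowth c) :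
    SlowGrowth fun n => e n * c n := by
  obtain ⟨C, hC⟩ := hc
  refine ⟨C, fun n => ?_⟩
  rw [abs_mul]
  exact (mul_le_of_le_one_left (abs_nonneg _) (he n)).trans (hC n)

theorem SlowGrowth.sign_mul {c : ℕ → ℝ} (hc : SlowGrowth c) :
    SlowGrowth fun n => (-1) ^ n * c n := hc.bounded_mul abs_neg_one_pow_le

theorem summable_mul_div_pow {c d : ℕ → ℝ} (hc : SlowGrowth c) (hd : SlowGrowth d) {q : ℕ}
    (hq : 2 ≤ q) : Summable fun n : ℕ => c n * d n / (n : ℝ) ^ q := by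
  obtain ⟨C, hC⟩ := hc
  obtain ⟨D, hD⟩ := hd
  have hs := (Real.summable_nat_rpow (p := -(3 / 2))).2 (by norm_num) |>.mul_left (C * D)
  refine Summable.of_norm_bounded hs fun n => ?_
  rcases Nat.eq_zero_or_pos n with rfl | hn
  · have : q ≠ 0 := by omega
    simp [this]
  have h1 : (1 : ℝ) ≤ n := by exact_mod_cast hn
  have h0 : (0 : ℝ) < n := by linarith
  rw [Real.norm_eq_abs, abs_div, abs_mul, abs_of_nonneg (by positivity : (0 : ℝ) ≤ (n : ℝ) ^ q)]
  have hm := mul_le_mul (hC n) (hD n) (abs_nonneg _) ((abs_nonneg _).trans (hC n))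
  have hp : (n : ℝ) ^ (2 : ℕ) ≤ (n : ℝ) ^ q := pow_le_pow_right₀ h1 hq
  have he : (n : ℝ) ^ (1 / 4 : ℝ) * (n : ℝ) ^ (1 / 4 : ℝ) / (n : ℝ) ^ (2 : ℕ)
      = (n : ℝ) ^ (-(3 / 2) : ℝ) := by
    rw [← Real.rpow_natCast, ← Real.rpow_add h0, ← Real.rpow_sub h0]
    norm_num
  calc |c n| * |d n| / (n : ℝ) ^ q
      ≤ C * (n : ℝ) ^ (1 / 4 : ℝ) * (D * (n : ℝ) ^ (1 / 4 : ℝ)) / (n : ℝ) ^ (2 : ℕ) :=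
        div_le_div₀ ((mul_nonneg (abs_nonneg _) (abs_nonneg _)).trans hm) hm (by positivity) hp
    _ = C * D * ((n : ℝ) ^ (1 / 4 : ℝ) * (n : ℝ) ^ (1 / 4 : ℝ) / (n : ℝ) ^ (2 : ℕ)) := by ring
    _ = _ := by rw [he]

/-- `SlowGrowth` forces the value 0 at `n = 0`, so the constant 1 has to be cut off there. Division
by `n ^ q` makes the cut invisible. -/
theorem slowGrowth_one_of_pos : SlowGrowth fun n => if n = 0 then 0 else 1 := by
  refine ⟨1, fun n => ?_⟩
  rcases Nat.eq_zero_or_pos n with rfl | hn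
  · simp
  · have h1 : (1 : ℝ) ≤ n := by exact_mod_cast hn
    simpa [hn.ne'] using Real.one_le_rpow h1 (z := 1 / 4) (by norm_num)

theorem summable_div_pow {c : ℕ → ℝ} (hc : SlowGrowth c) {q : ℕ}
    (hq : 2 ≤ q) : Summable fun n : ℕ => c n / (n : ℝ) ^ q := by
  refine (summable_mul_div_pow hc slowGrowth_one_of_pos hq).congr fun n => ?_
  rcases Nat.eq_zero_or_pos n with rfl | hn
  · have : q ≠ 0 := by omega
    simp [this]
  · simp [hn.ne']

theorem summable_bounded_div_pow {e : ℕ → ℝ} (he : ∀ n, |e n| ≤ 1) {q : ℕ}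
    (hq : 2 ≤ q) : Summable fun n : ℕ => e n / (n : ℝ) ^ q := by
  refine (summable_div_pow (slowGrowth_one_of_pos.bounded_mul he) hq).congr fun n => ?_
  rcases Nat.eq_zero_or_pos n with rfl | hn
  · have : q ≠ 0 := by omega
    simp [this]
  · simp [hn.ne']

/-- The largest variable gives up its exponent 3/4, split as 3/8 to each of the other two: 3/4 + 3/8
= 9/8 exceeds 1, so a double series in the two smaller variables converges. -/
theorem rpow_mul_mul_le {x y z : ℝ} (hx : 0 < x) (hy : 0 < y) (hxz : x ≤ z) (hyz : y ≤ z) :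
    (x * y * z) ^ (-(3 / 4) : ℝ) ≤ (x * y) ^ (-(9 / 8) : ℝ) := by
  have hz : 0 < z := hx.trans_le hxz
  have h1 : (x * y) ^ (3 / 8 : ℝ) ≤ z ^ (3 / 4 : ℝ) := by
    calc (x * y) ^ (3 / 8 : ℝ) ≤ (z * z) ^ (3 / 8 : ℝ) := by gcongr
      _ = z ^ (3 / 4 : ℝ) := by
        rw [Real.mul_rpow hz.le hz.le, ← Real.rpow_add hz]; norm_num
  rw [Real.mul_rpow (by positivity) hz.le, Real.rpow_neg hz.le,
    show (-(9 / 8) : ℝ) = -(3 / 4) - 3 / 8 by norm_num, Real.rpow_sub (by positivity),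
    ← div_eq_mul_inv]
  gcongr

theorem rpow_mul_mul_le_add {x y z : ℝ} (hx : 0 < x) (hy : 0 < y) (hz : 0 < z) :
    (x * y * z) ^ (-(3 / 4) : ℝ) ≤ (x * y) ^ (-(9 / 8) : ℝ) + (x * z) ^ (-(9 / 8) : ℝ)
      + (y * z) ^ (-(9 / 8) : ℝ) := by
  have h1 : 0 ≤ (x * y) ^ (-(9 / 8) : ℝ) := by positivity
  have h2 : 0 ≤ (x * z) ^ (-(9 / 8) : ℝ) := by positivity
  have h3 : 0 ≤ (y * z) ^ (-(9 / 8) : ℝ) := by positivity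
  rcases le_total x y with hxy | hxy
  · rcases le_total y z with hyz | hyz
    · linarith [rpow_mul_mul_le hx hy (hxy.trans hyz) hyz]
    · have := rpow_mul_mul_le hx hz hxy hyz
      rw [mul_right_comm] at this
      linarith
  · rcases le_total x z with hxz | hxz
    · linarith [rpow_mul_mul_le hx hy hxz (hxy.trans hxz)]
    · have := rpow_mul_mul_le hy hz hxy hxz
      rw [show y * z * x = x * y * z by ring] at this
      linarith

theorem summable_rpow_mul_rpow {d₁ d₂ : ℕ × ℕ → ℤ}
    (hd : Function.Injective fun x => (d₁ x, d₂ x)) :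
    Summable fun x : ℕ × ℕ => (|(d₁ x : ℝ)| * |(d₂ x : ℝ)|) ^ (-(9 / 8) : ℝ) := by
  have h := Real.summable_abs_int_rpow (b := 9 / 8) (by norm_num)
  have h2 := (h.mul_of_nonneg h (fun _ => by positivity) fun _ => by positivity).comp_injective hd
  refine h2.congr fun x => ?_
  simp only [Function.comp]
  rw [Real.mul_rpow (by positivity) (by positivity)]

/-- The double series `∑ 1 / (a ^ (3 / 4) b |d|)`, where `d` is determined by `a` and `b`, and each
of `a` and `b` by `d` and the other one, is summable. -/
theorem summable_triple {d : ℕ × ℕ → ℤ} (h1 : Function.Injective fun x : ℕ × ℕ => ((x.1 : ℤ), d x))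
    (h2 : Function.Injective fun x : ℕ × ℕ => ((x.2 : ℤ), d x)) :
    Summable fun x : ℕ × ℕ => (x.1 : ℝ) ^ (1 / 4 : ℝ) / (x.1 * x.2 * |(d x : ℝ)|) := by
  have h3 : Function.Injective fun x : ℕ × ℕ => ((x.1 : ℤ), (x.2 : ℤ)) := by
    rintro ⟨a, b⟩ ⟨a', b'⟩ h
    simpa using h
  refine Summable.of_nonneg_of_le (fun x => by positivity) (fun x => ?_)
    (((summable_rpow_mul_rpow h3).add (summable_rpow_mul_rpow h1)).add (summable_rpow_mul_rpow h2))
  obtain ⟨a, b⟩ := x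
  simp only [Int.cast_natCast, Nat.abs_cast]
  rcases Nat.eq_zero_or_pos a with rfl | ha
  · simp; positivity
  rcases Nat.eq_zero_or_pos b with rfl | hb
  · simp; positivity
  by_cases hd : d (a, b) = 0
  · simp [hd]; positivity
  have ha' : (1 : ℝ) ≤ a := by exact_mod_cast ha
  have hb' : (1 : ℝ) ≤ b := by exact_mod_cast hb
  have hd' : (1 : ℝ) ≤ |(d (a, b) : ℝ)| := by exact_mod_cast Int.one_le_abs hd
  have ha0 : (0 : ℝ) < a := by linarith
  refine le_trans ?_ (rpow_mul_mul_le_add ha0 (by linarith) (by linarith))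
  have hle : ∀ t : ℝ, 1 ≤ t → t⁻¹ ≤ t ^ (-(3 / 4) : ℝ) := fun t ht => by
    rw [← Real.rpow_neg_one]
    exact Real.rpow_le_rpow_of_exponent_le ht (by norm_num)
  calc (a : ℝ) ^ (1 / 4 : ℝ) / (a * b * |(d (a, b) : ℝ)|)
      = (a : ℝ) ^ (1 / 4 - 1 : ℝ) * (b : ℝ)⁻¹ * |(d (a, b) : ℝ)|⁻¹ := by
        rw [Real.rpow_sub_one ha0.ne']; field_simp
    _ ≤ (a : ℝ) ^ (-(3 / 4) : ℝ) * (b : ℝ) ^ (-(3 / 4) : ℝ) * |(d (a, b) : ℝ)| ^ (-(3 / 4) : ℝ) := by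
        rw [show (1 / 4 - 1 : ℝ) = -(3 / 4) by norm_num]
        gcongr
        · exact hle _ hb'
        · exact hle _ hd'
    _ = _ := by
        rw [Real.mul_rpow (by positivity) (by positivity), Real.mul_rpow ha0.le (by positivity)]

theorem summable_sub_kernel {c : ℕ → ℝ} (hc : SlowGrowth c) :
    Summable fun x : ℕ × ℕ => |c x.1| / (x.1 * x.2 * |(x.1 : ℝ) - x.2|) := by
  obtain ⟨C, hC⟩ := hc
  have := (summable_triple (d := fun x => (x.1 : ℤ) - x.2)
    (by rintro ⟨a, b⟩ ⟨a', b'⟩ h; simp at h ⊢; omega)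
    (by rintro ⟨a, b⟩ ⟨a', b'⟩ h; simp at h ⊢; omega)).mul_left C
  refine Summable.of_nonneg_of_le (fun x => by positivity) (fun x => ?_) this
  rw [← mul_div_assoc]
  push_cast
  gcongr
  exact hC _

theorem summable_add_kernel {c : ℕ → ℝ} (hc : SlowGrowth c) :
    Summable fun x : ℕ × ℕ => |c x.1| / (x.1 * x.2 * |(x.1 : ℝ) + x.2|) := by
  obtain ⟨C, hC⟩ := hc
  have := (summable_triple (d := fun x => (x.1 : ℤ) + x.2)
    (by rintro ⟨a, b⟩ ⟨a', b'⟩ h; simp at h ⊢; omega)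
    (by rintro ⟨a, b⟩ ⟨a', b'⟩ h; simp at h ⊢; omega)).mul_left C
  refine Summable.of_nonneg_of_le (fun x => by positivity) (fun x => ?_) this
  rw [← mul_div_assoc]
  push_cast
  gcongr
  exact hC _

/-! ### Products of series through partial fractions -/

theorem sum_Icc_two_succ_div {p : ℕ} (hp : 1 ≤ p) (u : ℕ → ℝ) (b : ℝ) :
    ∑ j ∈ Finset.Icc 2 (p + 1), u j / b ^ (p + 1 + 2 - j)
      = (∑ j ∈ Finset.Icc 2 p, u j / b ^ (p + 2 - j)) / b + u (p + 1) / b ^ 2 := by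
  rw [Finset.sum_Icc_succ_top (by omega), Finset.sum_div]
  congr 1
  · refine Finset.sum_congr rfl fun j hj => ?_
    have := (Finset.mem_Icc.1 hj).2
    rw [show p + 1 + 2 - j = p + 2 - j + 1 by omega, pow_succ, div_div]
  · rw [show p + 1 + 2 - (p + 1) = 2 by omega]

/-- A geometric progression of ratio `b / a`. If `a` or `b` is 0, both sides vanish by `1 / 0 = 0`,
so double sums over `ℕ × ℕ` need no special treatment of index 0. -/
theorem sum_geom_sub {p : ℕ} (hp : 1 ≤ p) {a b : ℝ} (hab : a ≠ b) :
    ∑ j ∈ Finset.Icc 2 p, 1 / a ^ j / b ^ (p + 2 - j)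
      = 1 / b ^ p / (a * (a - b)) - 1 / a ^ p / (b * (a - b)) := by
  have hd : a - b ≠ 0 := sub_ne_zero.2 hab
  rcases eq_or_ne a 0 with rfl | ha
  · rw [Finset.sum_eq_zero fun j hj => ?_]
    · simp [show p ≠ 0 by omega]
    · have := (Finset.mem_Icc.1 hj).1
      simp [show j ≠ 0 by omega]
  rcases eq_or_ne b 0 with rfl | hb
  · rw [Finset.sum_eq_zero fun j hj => ?_]
    · simp [show p ≠ 0 by omega]
    · have := (Finset.mem_Icc.1 hj).2
      simp [show p + 2 - j ≠ 0 by omega]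
  induction p, hp using Nat.le_induction with
  | base => simp; field_simp; simp
  | succ p hp ih =>
    rw [sum_Icc_two_succ_div hp, ih]
    field_simp
    ring

/-- This is `sum_geom_sub` with `a` replaced by `-a`; for nonnegative arguments the denominator `a +
b` vanishes only at the origin. -/
theorem sum_geom_add {p : ℕ} (hp : 1 ≤ p) {a b : ℝ} (ha : 0 ≤ a) (hb : 0 ≤ b) :
    ∑ j ∈ Finset.Icc 2 p, (-1) ^ j * (1 / a ^ j / b ^ (p + 2 - j))
      = 1 / b ^ p / (a * (a + b)) + (-1) ^ p * (1 / a ^ p / (b * (a + b))) := by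
  rcases eq_or_lt_of_le ha with rfl | ha
  · rw [Finset.sum_eq_zero fun j hj => ?_]
    · simp [show p ≠ 0 by omega]
    · have := (Finset.mem_Icc.1 hj).1
      simp [show j ≠ 0 by omega]
  rcases eq_or_lt_of_le hb with rfl | hb
  · rw [Finset.sum_eq_zero fun j hj => ?_]
    · simp [show p ≠ 0 by omega]
    · have := (Finset.mem_Icc.1 hj).2
      simp [show p + 2 - j ≠ 0 by omega]
  have hd : a + b ≠ 0 := by positivity
  simp only [← mul_div_assoc]
  induction p, hp using Nat.le_induction with
  | base => simp; field_simp; simp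
  | succ p hp ih =>
    rw [sum_Icc_two_succ_div hp, ih]
    field_simp
    ring

theorem sum_diag (p : ℕ) (hp : 1 ≤ p) (a : ℝ) :
    ∑ j ∈ Finset.Icc 2 p, 1 / a ^ j / a ^ (p + 2 - j) = ((p : ℝ) - 1) / a ^ (p + 2) := by
  rw [Finset.sum_congr rfl (g := fun _ => 1 / a ^ (p + 2)) fun j hj => ?_]
  · rw [Finset.sum_const, Nat.card_Icc, nsmul_eq_mul, show p + 1 - 2 = p - 1 by omega,
      Nat.cast_sub hp]
    simp [div_eq_mul_inv]
  · have := (Finset.mem_Icc.1 hj).2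
    rw [div_div, ← pow_add]
    congr 2
    omega

section

variable {c e : ℕ → ℝ} {p : ℕ}

theorem pow_bound (hp : 1 ≤ p) (n : ℕ) : 1 / (n : ℝ) ^ p ≤ 1 / (n : ℝ) := by
  rcases Nat.eq_zero_or_pos n with rfl | hn
  · simp [show p ≠ 0 by omega]
  · have h1 : (1 : ℝ) ≤ n := by exact_mod_cast hn
    have : (n : ℝ) ^ 1 ≤ (n : ℝ) ^ p := pow_le_pow_right₀ h1 hp
    rw [pow_one] at this
    gcongr

theorem abs_kernel_le (he : ∀ n, |e n| ≤ 1) (hp : 1 ≤ p) (a b : ℕ) (t : ℝ) :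
    |c a * e b * (1 / (b : ℝ) ^ p / (a * t))| ≤ |c a| / (a * b * |t|) := by
  have h := pow_bound hp b
  calc |c a * e b * (1 / (b : ℝ) ^ p / (a * t))|
      = |c a| * |e b| * (1 / (b : ℝ) ^ p / (a * |t|)) := by
        simp [abs_mul, abs_div]
    _ ≤ |c a| * 1 * (1 / (b : ℝ) / (a * |t|)) := by
        have := he b
        gcongr
    _ = _ := by rw [mul_one, div_div, mul_one_div]; congr 1; ring

theorem abs_kernel_le' (he : ∀ n, |e n| ≤ 1) (hp : 1 ≤ p) (a b : ℕ) (t : ℝ) :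
    |c a * e b * (1 / (a : ℝ) ^ p / (b * t))| ≤ |c a| / (a * b * |t|) := by
  have h := pow_bound hp a
  calc |c a * e b * (1 / (a : ℝ) ^ p / (b * t))|
      = |c a| * |e b| * (1 / (a : ℝ) ^ p / (b * |t|)) := by
        simp [abs_mul, abs_div]
    _ ≤ |c a| * 1 * (1 / (a : ℝ) / (b * |t|)) := by
        have := he b
        gcongr
    _ = _ := by rw [mul_one, div_div, mul_one_div]; congr 1; ring

theorem summable_sub_left (hc : SlowGrowth c) (he : ∀ n, |e n| ≤ 1) (hp : 1 ≤ p) :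
    Summable fun x : ℕ × ℕ => c x.1 * e x.2 * (1 / (x.2 : ℝ) ^ p / (x.1 * (x.1 - x.2))) :=
  .of_norm_bounded (summable_sub_kernel hc) fun _ => abs_kernel_le he hp _ _ _

theorem summable_sub_right (hc : SlowGrowth c) (he : ∀ n, |e n| ≤ 1) (hp : 1 ≤ p) :
    Summable fun x : ℕ × ℕ => c x.1 * e x.2 * (1 / (x.1 : ℝ) ^ p / (x.2 * (x.1 - x.2))) :=
  .of_norm_bounded (summable_sub_kernel hc) fun _ => abs_kernel_le' he hp _ _ _

theorem summable_add_left (hc : SlowGrowth c) (he : ∀ n, |e n| ≤ 1) (hp : 1 ≤ p) :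
    Summable fun x : ℕ × ℕ => c x.1 * e x.2 * (1 / (x.2 : ℝ) ^ p / (x.1 * (x.1 + x.2))) :=
  .of_norm_bounded (summable_add_kernel hc) fun _ => abs_kernel_le he hp _ _ _

theorem summable_add_right (hc : SlowGrowth c) (he : ∀ n, |e n| ≤ 1) (hp : 1 ≤ p) :
    Summable fun x : ℕ × ℕ => c x.1 * e x.2 * (1 / (x.1 : ℝ) ^ p / (x.2 * (x.1 + x.2))) :=
  .of_norm_bounded (summable_add_kernel hc) fun _ => abs_kernel_le' he hp _ _ _

theorem tsum_left {k : ℕ × ℕ → ℝ}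
    (h : Summable fun x : ℕ × ℕ => c x.1 * e x.2 * (1 / (x.2 : ℝ) ^ p / k x)) :
    ∑' x : ℕ × ℕ, c x.1 * e x.2 * (1 / (x.2 : ℝ) ^ p / k x)
      = ∑' b : ℕ, e b / (b : ℝ) ^ p * ∑' a, c a / k (a, b) := by
  rw [← (Equiv.prodComm ℕ ℕ).tsum_eq]
  refine ((Equiv.prodComm ℕ ℕ).summable_iff.2 h).tsum_prod.trans (tsum_congr fun b => ?_)
  rw [← tsum_mul_left]
  refine tsum_congr fun a => ?_
  simp only [Function.comp, Equiv.prodComm_apply, Prod.swap_prod_mk]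
  ring

theorem summable_left {k : ℕ × ℕ → ℝ}
    (h : Summable fun x : ℕ × ℕ => c x.1 * e x.2 * (1 / (x.2 : ℝ) ^ p / k x)) :
    Summable fun b : ℕ => e b / (b : ℝ) ^ p * ∑' a, c a / k (a, b) := by
  refine ((Equiv.prodComm ℕ ℕ).summable_iff.2 h).prod.congr fun b => ?_
  rw [← tsum_mul_left]
  refine tsum_congr fun a => ?_
  simp only [Function.comp, Equiv.prodComm_apply, Prod.swap_prod_mk]
  ring

theorem tsum_right {k : ℕ × ℕ → ℝ}
    (h : Summable fun x : ℕ × ℕ => c x.1 * e x.2 * (1 / (x.1 : ℝ) ^ p / k x)) :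
    ∑' x : ℕ × ℕ, c x.1 * e x.2 * (1 / (x.1 : ℝ) ^ p / k x)
      = ∑' a : ℕ, c a / (a : ℝ) ^ p * ∑' b, e b / k (a, b) := by
  rw [h.tsum_prod]
  refine tsum_congr fun a => ?_
  rw [← tsum_mul_left]
  refine tsum_congr fun b => ?_
  ring

theorem summable_prod_term (hc : SlowGrowth c) (he : ∀ n, |e n| ≤ 1) {i j : ℕ} (hi : 2 ≤ i)
    (hj : 2 ≤ j) : Summable fun x : ℕ × ℕ => c x.1 / (x.1 : ℝ) ^ i * (e x.2 / (x.2 : ℝ) ^ j) :=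
  summable_mul_of_summable_norm (summable_div_pow hc hi).norm (summable_bounded_div_pow he hj).norm

theorem tsum_mul_tsum_prod (hc : SlowGrowth c) (he : ∀ n, |e n| ≤ 1) {i j : ℕ} (hi : 2 ≤ i)
    (hj : 2 ≤ j) : (∑' a : ℕ, c a / (a : ℝ) ^ i) * ∑' b : ℕ, e b / (b : ℝ) ^ j
      = ∑' x : ℕ × ℕ, c x.1 / (x.1 : ℝ) ^ i * (e x.2 / (x.2 : ℝ) ^ j) :=
  tsum_mul_tsum_of_summable_norm (summable_div_pow hc hi).norm (summable_bounded_div_pow he hj).norm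

theorem sum_mul_tsum_sub (hc : SlowGrowth c) (he : ∀ n, |e n| ≤ 1) (hp : 1 ≤ p) :
    ∑ j ∈ Finset.Icc 2 p, (∑' a : ℕ, c a / (a : ℝ) ^ j) * ∑' b : ℕ, e b / (b : ℝ) ^ (p + 2 - j)
      = ((p : ℝ) - 1) * ∑' a : ℕ, c a * e a / (a : ℝ) ^ (p + 2)
        + ∑' b : ℕ, e b / (b : ℝ) ^ p * ∑' a : ℕ, c a / ((a : ℝ) * (a - b))
        - ∑' a : ℕ, c a / (a : ℝ) ^ p * ∑' b : ℕ, e b / ((b : ℝ) * (a - b)) := by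
  have hj : ∀ j ∈ Finset.Icc 2 p, 2 ≤ j ∧ 2 ≤ p + 2 - j := fun j hj => by
    rw [Finset.mem_Icc] at hj
    omega
  have h1 := summable_sub_left hc he hp
  have h2 := summable_sub_right hc he hp
  have h3 : ∀ j ∈ Finset.Icc 2 p, Summable fun x : ℕ × ℕ =>
      c x.1 / (x.1 : ℝ) ^ j * (e x.2 / (x.2 : ℝ) ^ (p + 2 - j)) := fun j h =>
    summable_prod_term hc he (hj j h).1 (hj j h).2
  -- Off the diagonal this is the partial fraction identity; on it both kernels are 0 by convention
  -- and the `p - 1` products coincide.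
  have hd : ∀ x : ℕ × ℕ,
      ∑ j ∈ Finset.Icc 2 p, c x.1 / (x.1 : ℝ) ^ j * (e x.2 / (x.2 : ℝ) ^ (p + 2 - j))
        - c x.1 * e x.2 * (1 / (x.2 : ℝ) ^ p / (x.1 * (x.1 - x.2)))
        + c x.1 * e x.2 * (1 / (x.1 : ℝ) ^ p / (x.2 * (x.1 - x.2)))
      = if x.2 = x.1 then ((p : ℝ) - 1) * (c x.1 * e x.1 / (x.1 : ℝ) ^ (p + 2)) else 0 := by
    rintro ⟨a, b⟩
    have hs : ∑ j ∈ Finset.Icc 2 p, c a / (a : ℝ) ^ j * (e b / (b : ℝ) ^ (p + 2 - j))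
        = c a * e b * ∑ j ∈ Finset.Icc 2 p, 1 / (a : ℝ) ^ j / (b : ℝ) ^ (p + 2 - j) := by
      rw [Finset.mul_sum]
      exact Finset.sum_congr rfl fun _ _ => by ring
    simp only [hs]
    split_ifs with h
    · subst h
      rw [sum_diag p hp]
      simp only [sub_self, mul_zero, div_zero]
      ring
    · rw [sum_geom_sub hp (by simpa using fun h' => h h'.symm)]
      ring
  have h4 := ((summable_sum h3).sub h1).add h2
  have h5 : ∑' x : ℕ × ℕ, (if x.2 = x.1 then
        ((p : ℝ) - 1) * (c x.1 * e x.1 / (x.1 : ℝ) ^ (p + 2)) else 0)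
      = ((p : ℝ) - 1) * ∑' a : ℕ, c a * e a / (a : ℝ) ^ (p + 2) := by
    rw [(h4.congr fun x => hd x).tsum_prod, ← tsum_mul_left]
    exact tsum_congr fun a => tsum_ite_eq a _
  rw [← tsum_left (k := fun x => (x.1 : ℝ) * (x.1 - x.2)) h1,
    ← tsum_right (k := fun x => (x.2 : ℝ) * (x.1 - x.2)) h2, ← h5, ← tsum_congr hd,
    ((summable_sum h3).sub h1).tsum_add h2, (summable_sum h3).tsum_sub h1,
    Summable.tsum_finsetSum h3]
  rw [Finset.sum_congr rfl fun j h => tsum_mul_tsum_prod hc he (hj j h).1 (hj j h).2]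
  ring

theorem sum_mul_tsum_add (hc : SlowGrowth c) (he : ∀ n, |e n| ≤ 1) (hp : 1 ≤ p) :
    ∑ j ∈ Finset.Icc 2 p, (-1) ^ j *
        ((∑' a : ℕ, c a / (a : ℝ) ^ j) * ∑' b : ℕ, e b / (b : ℝ) ^ (p + 2 - j))
      = ∑' b : ℕ, e b / (b : ℝ) ^ p * ∑' a : ℕ, c a / ((a : ℝ) * (a + b))
        + (-1) ^ p * ∑' a : ℕ, c a / (a : ℝ) ^ p * ∑' b : ℕ, e b / ((b : ℝ) * (a + b)) := by
  have hj : ∀ j ∈ Finset.Icc 2 p, 2 ≤ j ∧ 2 ≤ p + 2 - j := fun j hj => by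
    rw [Finset.mem_Icc] at hj
    omega
  have h1 := summable_add_left hc he hp
  have h2 := summable_add_right hc he hp
  have h3 : ∀ j ∈ Finset.Icc 2 p, Summable fun x : ℕ × ℕ =>
      (-1) ^ j * (c x.1 / (x.1 : ℝ) ^ j * (e x.2 / (x.2 : ℝ) ^ (p + 2 - j))) := fun j h =>
    (summable_prod_term hc he (hj j h).1 (hj j h).2).mul_left _
  rw [← tsum_left (k := fun x => (x.1 : ℝ) * (x.1 + x.2)) h1,
    ← tsum_right (k := fun x => (x.2 : ℝ) * (x.1 + x.2)) h2, ← tsum_mul_left,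
    ← h1.tsum_add (h2.mul_left _)]
  rw [Finset.sum_congr rfl fun j h => by
    rw [tsum_mul_tsum_prod hc he (hj j h).1 (hj j h).2, ← tsum_mul_left],
    ← Summable.tsum_finsetSum h3]
  refine tsum_congr fun x => ?_
  have hs := congrArg (c x.1 * e x.2 * ·)
    (sum_geom_add hp (Nat.cast_nonneg (α := ℝ) x.1) (Nat.cast_nonneg x.2))
  simp only [Finset.mul_sum] at hs
  rw [Finset.sum_congr rfl fun j _ => show _ = c x.1 * e x.2 *
    ((-1) ^ j * (1 / (x.1 : ℝ) ^ j / (x.2 : ℝ) ^ (p + 2 - j))) by ring, hs]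
  ring

end

/-! ### The inner sums -/

theorem summable_fiber_sub {c : ℕ → ℝ} (hc : SlowGrowth c) {b : ℕ} (hb : 1 ≤ b) :
    Summable fun a : ℕ => c a / ((a : ℝ) * (a - b)) := by
  have h := summable_sub_left hc (e := fun _ => 1) (by simp) le_rfl
  have hb' : (b : ℝ) ≠ 0 := by positivity
  -- The row of the double series for `p = 1` carries an extra factor `1 / b`, which multiplication
  -- by `b` removes.
  refine ((((Equiv.prodComm ℕ ℕ).summable_iff.2 h).prod_factor b).mul_left (b : ℝ)).congr
    fun a => ?_
  simp only [Function.comp, Equiv.prodComm_apply, Prod.swap_prod_mk]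
  field_simp

theorem summable_fiber_add {c : ℕ → ℝ} (hc : SlowGrowth c) {b : ℕ} (hb : 1 ≤ b) :
    Summable fun a : ℕ => c a / ((a : ℝ) * (a + b)) := by
  have h := summable_add_left hc (e := fun _ => 1) (by simp) le_rfl
  have hb' : (b : ℝ) ≠ 0 := by positivity
  refine ((((Equiv.prodComm ℕ ℕ).summable_iff.2 h).prod_factor b).mul_left (b : ℝ)).congr
    fun a => ?_
  simp only [Function.comp, Equiv.prodComm_apply, Prod.swap_prod_mk]
  field_simp

theorem summable_fiber_add_of_bounded {e : ℕ → ℝ} (he : ∀ n, |e n| ≤ 1) {b : ℕ} (hb : 1 ≤ b) :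
    Summable fun a : ℕ => e a / ((a : ℝ) * (a + b)) := by
  refine (summable_fiber_add (slowGrowth_one_of_pos.bounded_mul he) hb).congr fun n => ?_
  rcases Nat.eq_zero_or_pos n with rfl | hn
  · simp
  · simp [hn.ne']

theorem hasSum_of_tendsto_range_succ {f : ℕ → ℝ} {s : ℝ} (hf : Summable f)
    (h : Tendsto (fun M => ∑ a ∈ Finset.range (M + 1), f a) atTop (𝓝 s)) : HasSum f s :=
  hf.hasSum_iff_tendsto_nat.2 ((tendsto_add_atTop_iff_nat 1).1 h)

/-- The value of `b ∑ (-1) ^ a / (a (a + b))`. -/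
noncomputable def altAdd (b : ℕ) : ℝ := -Real.log 2 + (-1) ^ b * (Real.log 2 - L 1 b)

/-- Since `b / (a (a + b)) = 1 / a - 1 / (a + b)`, the partial sums are values of `L 1` at `M` and
at the shifted index `M + b`. -/
theorem hasSum_alt_add {b : ℕ} (hb : 1 ≤ b) :
    HasSum (fun a : ℕ => (-1 : ℝ) ^ a / ((a : ℝ) * (a + b))) (altAdd b / b) := by
  have hb' : (b : ℝ) ≠ 0 := by positivity
  refine hasSum_of_tendsto_range_succ (summable_fiber_add_of_bounded abs_neg_one_pow_le hb) ?_
  have hp : ∀ M : ℕ, (-L 1 M + (-1) ^ b * (L 1 (M + b) - L 1 b)) / b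
      = ∑ a ∈ Finset.range (M + 1), (-1 : ℝ) ^ a / ((a : ℝ) * (a + b)) := by
    intro M
    induction M with
    | zero => simp [L_zero]
    | succ M ih =>
      rw [Finset.sum_range_succ, ← ih, show M + 1 + b = M + b + 1 by ring, L_succ, L_succ]
      have h1 : (M : ℝ) + 1 ≠ 0 := by positivity
      have h2 : (M : ℝ) + b + 1 ≠ 0 := by positivity
      have h3 : (M : ℝ) + 1 + b ≠ 0 := by positivity
      have h4 := neg_one_pow_mul_self b
      rw [pow_add (-1 : ℝ) M b, pow_succ (-1 : ℝ) M]
      push_cast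
      field_simp
      linear_combination ((M : ℝ) + 1) * (-1) ^ M * (M + 1 + b) * h4
  refine Tendsto.congr hp ?_
  have h := tendsto_L_one
  exact (h.neg.add ((((tendsto_add_atTop_iff_nat b).2 h).sub_const _).const_mul _)).div_const _

theorem hasSum_one_add {b : ℕ} (hb : 1 ≤ b) :
    HasSum (fun a : ℕ => 1 / ((a : ℝ) * (a + b))) (H b / b) := by
  have hb' : (b : ℝ) ≠ 0 := by positivity
  refine hasSum_of_tendsto_range_succ
    (summable_fiber_add_of_bounded (e := fun _ => 1) (by simp) hb) ?_
  have hp : ∀ M : ℕ, (H b - (H (M + b) - H M)) / b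
      = ∑ a ∈ Finset.range (M + 1), 1 / ((a : ℝ) * (a + b)) := by
    intro M
    induction M with
    | zero => simp [H_zero]
    | succ M ih =>
      rw [Finset.sum_range_succ, ← ih, show M + 1 + b = M + b + 1 by ring, H_succ, H_succ]
      have h1 : (M : ℝ) + 1 ≠ 0 := by positivity
      have h2 : (M : ℝ) + b + 1 ≠ 0 := by positivity
      have h3 : (M : ℝ) + 1 + b ≠ 0 := by positivity
      push_cast
      field_simp
      ring
  refine Tendsto.congr hp ?_
  have h := ((tendsto_H_shift_sub b).const_sub (H b)).div_const (b : ℝ)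
  rwa [sub_zero] at h

theorem L_eq_sum_range (m : ℕ) : L 1 m = -∑ b ∈ Finset.range (m + 1), (-1 : ℝ) ^ b / (b : ℝ) := by
  induction m with
  | zero => simp [L_zero]
  | succ m ih =>
    rw [Finset.sum_range_succ, L_succ, ih, pow_succ]
    push_cast
    ring

theorem H_eq_sum_range (m : ℕ) : H m = ∑ b ∈ Finset.range (m + 1), 1 / (b : ℝ) := by
  induction m with
  | zero => simp [H_zero]
  | succ m ih =>
    rw [Finset.sum_range_succ, H_succ, ih]
    push_cast
    ring

theorem sum_range_pow_div_sub {ε : ℝ} (hε : ε * ε = 1) (m : ℕ) :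
    ∑ b ∈ Finset.range m, ε ^ (b + 1) / ((m : ℝ) - b)
      = ε ^ (m + 1) * ∑ b ∈ Finset.range m, ε ^ (b + 1) / ((b : ℝ) + 1) := by
  rw [← Finset.sum_range_reflect, Finset.mul_sum]
  refine Finset.sum_congr rfl fun b hb => ?_
  have hb' := Finset.mem_range.1 hb
  have hcast : ((m - 1 - b : ℕ) : ℝ) = m - 1 - b := by
    rw [Nat.cast_sub (by omega), Nat.cast_sub (by omega)]; simp
  rw [hcast, show (m : ℝ) - (m - 1 - b) = b + 1 by ring, ← mul_div_assoc]
  congr 1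
  rw [show m - 1 - b + 1 = m - b by omega]
  have h2 : ε ^ (b + 1) * ε ^ (b + 1) = 1 := by rw [← mul_pow, hε, one_pow]
  calc ε ^ (m - b) = ε ^ (m - b) * (ε ^ (b + 1) * ε ^ (b + 1)) := by rw [h2, mul_one]
    _ = ε ^ (m - b + (b + 1)) * ε ^ (b + 1) := by rw [pow_add]; ring
    _ = _ := by rw [show m - b + (b + 1) = m + 1 by omega]

/-- With `n = m + 1`, `n / (b (n - b)) = 1 / b + 1 / (n - b)`, and the reflection `b ↦ n - b` turns
the second half into `ε ^ n` times the first. The term `b = n` is 0. -/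
theorem sum_range_sub_kernel {ε : ℝ} (hε : ε * ε = 1) (m : ℕ) :
    ∑ b ∈ Finset.range (m + 2), ε ^ b / ((b : ℝ) * ((m + 1 : ℕ) - b))
      = (1 + ε ^ (m + 1)) * (∑ b ∈ Finset.range (m + 1), ε ^ b / (b : ℝ)) / (m + 1 : ℕ) := by
  rw [Finset.sum_range_succ, sub_self, mul_zero, div_zero, add_zero]
  rw [Finset.sum_range_succ', Finset.sum_range_succ' _ m]
  simp only [Nat.cast_zero, zero_mul, div_zero, add_zero]
  push_cast
  rw [add_mul, one_mul, ← sum_range_pow_div_sub hε, ← Finset.sum_add_distrib, Finset.sum_div]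
  refine Finset.sum_congr rfl fun b hb => ?_
  have hb' := Finset.mem_range.1 hb
  have h1 : (b : ℝ) + 1 ≠ 0 := by positivity
  have h2 : (m : ℝ) - b ≠ 0 := sub_ne_zero.2 (by exact_mod_cast hb'.ne')
  have h3 : (m : ℝ) + 1 ≠ 0 := by positivity
  rw [show (m : ℝ) + 1 - (b + 1) = m - b by ring, div_add_div _ _ h1 h2, div_div,
    div_eq_div_iff (mul_ne_zero h1 h2) (mul_ne_zero (mul_ne_zero h1 h2) h3)]
  ring

/-- The sum is cut at the pole `b = m + 1`: the part below is finite, and `b = m + 1 + c` turns the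
part above into `-ε ^ (m + 1)` times the sum for the kernel `1 / (c (c + m + 1))`. -/
theorem hasSum_sub_kernel {ε : ℝ} (hε : ε * ε = 1) (m : ℕ) {t : ℝ}
    (ht : HasSum (fun c : ℕ => ε ^ c / ((c : ℝ) * (c + (m + 1 : ℕ)))) t) :
    HasSum (fun b : ℕ => ε ^ b / ((b : ℝ) * ((m + 1 : ℕ) - b)))
      ((1 + ε ^ (m + 1)) * (∑ b ∈ Finset.range (m + 1), ε ^ b / (b : ℝ)) / (m + 1 : ℕ)
        - ε ^ (m + 1) * t) := by
  rw [← sum_range_sub_kernel hε, ← hasSum_nat_add_iff' (m + 2), sub_sub_cancel_left]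
  have h0 := (hasSum_nat_add_iff' 1).2 ht
  simp only [Finset.range_one, Finset.sum_singleton, Nat.cast_zero, zero_mul, div_zero,
    sub_zero] at h0
  refine (h0.mul_left (ε ^ (m + 1))).neg.congr_fun fun c => ?_
  have h1 : (c : ℝ) + 1 ≠ 0 := by positivity
  have h2 : (c : ℝ) + 1 + (m + 1) ≠ 0 := by positivity
  rw [show c + (m + 2) = m + 1 + (c + 1) by ring, pow_add ε (m + 1)]
  push_cast
  rw [show (m : ℝ) + 1 - (m + 1 + (c + 1)) = -(c + 1) by ring, mul_neg, div_neg,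
    mul_comm ((m : ℝ) + 1 + (c + 1)), add_comm ((m : ℝ) + 1), mul_div_assoc]

theorem hasSum_one_sub {a : ℕ} (ha : 1 ≤ a) :
    HasSum (fun b : ℕ => 1 / ((b : ℝ) * (a - b))) ((H a - 2 / a) / a) := by
  obtain ⟨m, rfl⟩ : ∃ m, a = m + 1 := ⟨a - 1, by omega⟩
  have h := hasSum_sub_kernel (ε := 1) (by norm_num) m (t := H (m + 1) / (m + 1 : ℕ))
    (by simpa only [one_pow] using hasSum_one_add ha)
  simp only [one_pow, ← H_eq_sum_range] at h
  convert h using 1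
  rw [H_succ]
  have h1 : (m : ℝ) + 1 ≠ 0 := by positivity
  push_cast
  field_simp
  ring

/-- The value of `a ∑ (-1) ^ b / (b (a - b))`. -/
noncomputable def altSub (a : ℕ) : ℝ :=
  -Real.log 2 + (-1) ^ a * Real.log 2 - (-1) ^ a * L 1 a - (-1) ^ a / a - 1 / a

theorem hasSum_alt_sub {a : ℕ} (ha : 1 ≤ a) :
    HasSum (fun b : ℕ => (-1 : ℝ) ^ b / ((b : ℝ) * (a - b))) (altSub a / a) := by
  obtain ⟨m, rfl⟩ : ∃ m, a = m + 1 := ⟨a - 1, by omega⟩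
  have h := hasSum_sub_kernel (ε := -1) (by norm_num) m (hasSum_alt_add ha)
  rw [show ∑ b ∈ Finset.range (m + 1), (-1 : ℝ) ^ b / (b : ℝ) = -L 1 m by
    rw [L_eq_sum_range, neg_neg]] at h
  convert h using 1
  have h1 : (m : ℝ) + 1 ≠ 0 := by positivity
  have h4 := neg_one_pow_mul_self m
  rw [altSub, altAdd, L_succ, pow_succ (-1 : ℝ) m]
  push_cast
  field_simp
  linear_combination (1 + (m + 1) * (Real.log 2 - L 1 m) - (-1) ^ m) * h4

theorem hasSum_zeta {s : ℕ} (hs : 2 ≤ s) : HasSum (fun n : ℕ => 1 / (n : ℝ) ^ s) (zeta s) := by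
  have h : Summable fun n : ℕ => 1 / (n : ℝ) ^ s := Real.summable_one_div_nat_pow.2 (by omega)
  have hz : (∑' n : ℕ, 1 / (n : ℝ) ^ s) = zeta s := by
    rw [zeta, h.tsum_eq_zero_add]
    simp [show s ≠ 0 by omega]
  rw [← hz]
  exact h.hasSum

/-- The even terms of `zeta 2` make up a quarter of it, so the signed sum is 1/4 - 3/4 = -1/2 of it.
-/
theorem hasSum_alt_sq :
    HasSum (fun n : ℕ => (-1 : ℝ) ^ n / (n : ℝ) ^ 2) (-(zeta 2 / 2)) := by
  have hA := hasSum_zeta (s := 2) le_rfl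
  have hE : HasSum (fun k : ℕ => 1 / ((2 * k : ℕ) : ℝ) ^ 2) (zeta 2 / 4) := by
    refine (hA.div_const 4).congr_fun fun k => ?_
    push_cast
    rw [div_div, mul_pow]
    congr 1
    ring
  have hO : Summable fun k : ℕ => 1 / ((2 * k + 1 : ℕ) : ℝ) ^ 2 :=
    hA.summable.comp_injective (i := fun k : ℕ => 2 * k + 1) fun a b h => by
      simpa using h
  have hO' := hO.hasSum
  have hs := hA.unique (hE.even_add_odd (f := fun n : ℕ => 1 / (n : ℝ) ^ 2) hO')
  have hE2 : HasSum (fun k : ℕ => (-1 : ℝ) ^ (2 * k) / ((2 * k : ℕ) : ℝ) ^ 2) (zeta 2 / 4) := by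
    simpa only [pow_mul, neg_one_sq, one_pow] using hE
  have hO2 : HasSum (fun k : ℕ => (-1 : ℝ) ^ (2 * k + 1) / ((2 * k + 1 : ℕ) : ℝ) ^ 2)
      (-∑' k : ℕ, 1 / ((2 * k + 1 : ℕ) : ℝ) ^ 2) := by
    simpa only [pow_succ _ (2 * _), pow_mul, neg_one_sq, one_pow, one_mul, neg_div] using hO'.neg
  have := hE2.even_add_odd (f := fun n : ℕ => (-1 : ℝ) ^ n / (n : ℝ) ^ 2) hO2
  convert this using 1
  linarith

theorem tendsto_mul_inv_sub {u : ℕ → ℝ} (hu : ∀ n, |u n| ≤ H n) (b : ℕ) :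
    Tendsto (fun M : ℕ => u M * ((M : ℝ) - b)⁻¹) atTop (𝓝 0) := by
  refine (tendsto_add_atTop_iff_nat b).1 ?_
  have h1 : Tendsto (fun n : ℕ => (H (n + b) - H n) * (n : ℝ)⁻¹ + H n / n) atTop (𝓝 0) := by
    have := ((tendsto_H_shift_sub b).mul tendsto_inv_atTop_nhds_zero_nat).add tendsto_H_div
    simpa using this
  refine squeeze_zero_norm (fun n => ?_) h1
  rw [Real.norm_eq_abs, abs_mul, Nat.cast_add, add_sub_cancel_right, abs_inv, Nat.abs_cast,
    div_eq_mul_inv, ← add_mul, sub_add_cancel]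
  gcongr
  exact hu _

theorem tendsto_mul_inv_add {u : ℕ → ℝ} (hu : ∀ n, |u n| ≤ H n) (b : ℕ) :
    Tendsto (fun M : ℕ => u M * ((M : ℝ) + b)⁻¹) atTop (𝓝 0) := by
  refine squeeze_zero_norm (fun n => ?_) tendsto_H_div
  rcases Nat.eq_zero_or_pos n with rfl | hn
  · have : u 0 = 0 := by simpa [H_zero] using hu 0
    simp [this]
  · have hn' : (0 : ℝ) < n := by exact_mod_cast hn
    have := H_nonneg n
    rw [Real.norm_eq_abs, abs_mul, div_eq_mul_inv, abs_of_nonneg (by positivity : 0 ≤ ((n : ℝ) + b)⁻¹)]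
    gcongr
    · exact hu n
    · simp

theorem tendsto_sum_alt_sub (b : ℕ) :
    Tendsto (fun M : ℕ => ∑ a ∈ Finset.range M, (-1 : ℝ) ^ a / (((a : ℝ) + 1) * (a - b))) atTop
      (𝓝 (altSub (b + 1) / (b + 1 : ℕ))) := by
  have h := (hasSum_nat_add_iff' 1).2 (hasSum_alt_sub (a := b + 1) (by omega))
  simp only [Finset.range_one, Finset.sum_singleton, Nat.cast_zero, zero_mul, div_zero,
    sub_zero] at h
  refine h.tendsto_sum_nat.congr fun M => Finset.sum_congr rfl fun a _ => ?_
  push_cast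
  rw [add_sub_add_right_eq_sub, ← neg_sub (a : ℝ) b, pow_succ, mul_neg_one, mul_neg, neg_div_neg_eq]

/-- The value of `∑ L a (1 / (a - b) - 1 / a)`, without the pole at `a = b`. -/
noncomputable def hilbertL (b : ℕ) : ℝ :=
  -Real.log 2 * (L 1 b + H b) + L 2 b + (L 1 b ^ 2 - zetaN 2 b) / 2

theorem tendsto_hilbertL (b : ℕ) :
    Tendsto (fun M : ℕ => ∑ a ∈ Finset.range (M + 1), L 1 a * (((a : ℝ) - b)⁻¹ - (a : ℝ)⁻¹)) atTop
      (𝓝 (hilbertL b)) := by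
  induction b with
  | zero => simp [hilbertL, L_zero, H_zero, zetaN_zero]
  | succ b ih =>
    -- Summation by parts: the shift `a ↦ a + 1` carries the pole from `b` to `b + 1`, replaces `L
    -- 1` by its increment, and leaves a boundary term that tends to 0. Accumulating the increments
    -- `altSub (b + 1) / (b + 1)` produces the square of `L 1 b`.
    have hid : ∀ M : ℕ,
        ∑ a ∈ Finset.range (M + 1), L 1 a * (((a : ℝ) - b)⁻¹ - (a : ℝ)⁻¹)
          + ∑ a ∈ Finset.range M, (-1 : ℝ) ^ a / (((a : ℝ) + 1) * (a - b))
          - L 1 M * ((M : ℝ) - b)⁻¹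
        = ∑ a ∈ Finset.range (M + 1), L 1 a * (((a : ℝ) - (b + 1 : ℕ))⁻¹ - (a : ℝ)⁻¹) := by
      intro M
      induction M with
      | zero => simp [L_zero]
      | succ M ih =>
        rw [Finset.sum_range_succ _ (M + 1), Finset.sum_range_succ _ (M + 1), ← ih,
          Finset.sum_range_succ (fun a : ℕ => (-1 : ℝ) ^ a / (((a : ℝ) + 1) * (a - b))) M, L_succ]
        push_cast
        rw [add_sub_add_right_eq_sub]
        simp only [div_eq_mul_inv, mul_inv, pow_one]
        ring
    refine Tendsto.congr hid ?_
    have h := (ih.add (tendsto_sum_alt_sub b)).sub (tendsto_mul_inv_sub (abs_L_le le_rfl) b)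
    convert h using 2
    rw [hilbertL, hilbertL, altSub, L_succ, L_succ, H_succ, zetaN_succ]
    have h1 : (b : ℝ) + 1 ≠ 0 := by positivity
    have h4 := neg_one_pow_mul_self b
    rw [pow_succ (-1 : ℝ) b]
    push_cast
    field_simp
    linear_combination -h4

theorem hasSum_L_sub {b : ℕ} (hb : 1 ≤ b) :
    HasSum (fun a : ℕ => L 1 a / ((a : ℝ) * (a - b))) ((hilbertL b + L 1 b / b) / b) := by
  have hb' : (b : ℝ) ≠ 0 := by positivity
  refine hasSum_of_tendsto_range_succ (summable_fiber_sub (SlowGrowth.L le_rfl) hb) ?_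
  refine (((tendsto_hilbertL b).add_const (L 1 b / b)).div_const (b : ℝ)).congr' ?_
  filter_upwards [eventually_ge_atTop b] with M hM
  -- At `a = b` the left side is 0, while the regularized term equals `-L 1 b / b`; the indicator
  -- restores the balance.
  have hp : ∀ a : ℕ, L 1 a / ((a : ℝ) * (a - b))
      = (L 1 a * (((a : ℝ) - b)⁻¹ - (a : ℝ)⁻¹) + if a = b then L 1 b / b else 0) / b := by
    intro a
    rcases Nat.eq_zero_or_pos a with rfl | ha
    · simp [L_zero, show 0 ≠ b by omega]
    have ha' : (a : ℝ) ≠ 0 := by positivity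
    split_ifs with h
    · subst h
      simp [div_eq_mul_inv]
    · have : (a : ℝ) - b ≠ 0 := sub_ne_zero.2 (by exact_mod_cast h)
      field_simp
      ring
  rw [Finset.sum_congr rfl fun a _ => hp a, ← Finset.sum_div, Finset.sum_add_distrib,
    Finset.sum_ite_eq' (Finset.range (M + 1)) b, if_pos (Finset.mem_range.2 (by omega))]

/-- The value of `∑ (-1) ^ a / (a (a + b))`. -/
noncomputable def altAddQuot (b : ℕ) : ℝ := if b = 0 then -(zeta 2 / 2) else altAdd b / b

theorem hasSum_altAddQuot (b : ℕ) :
    HasSum (fun a : ℕ => (-1 : ℝ) ^ a / ((a : ℝ) * (a + b))) (altAddQuot b) := by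
  rcases Nat.eq_zero_or_pos b with rfl | hb
  · simpa [altAddQuot, sq] using hasSum_alt_sq
  · simpa [altAddQuot, hb.ne'] using hasSum_alt_add hb

/-- The value of `∑ (-1) ^ a H a (1 / (a - b) - 1 / (a + b))`, without the pole at `a = b`. -/
noncomputable def hilbertH (b : ℕ) : ℝ :=
  -altAddQuot b + (-1) ^ b * (-(zeta 2 / 2) + zetaN 2 b - L 2 b)

theorem abs_sign_mul_H_le (n : ℕ) : |(-1) ^ n * H n| ≤ H n := by
  simp [abs_mul, abs_of_nonneg (H_nonneg n)]

/-- Here the shift of `a` also flips the sign, so the recurrence relates `hilbertH (b + 1)` to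
`-hilbertH b`. Either kernel alone would need the constant `∑ (-1) ^ a * H a / a`; in the difference
it cancels, and the value at `b = 0` is 0. -/
theorem tendsto_hilbertH (b : ℕ) :
    Tendsto (fun M : ℕ => ∑ a ∈ Finset.range (M + 1),
      (-1) ^ a * H a * (((a : ℝ) - b)⁻¹ - ((a : ℝ) + b)⁻¹)) atTop (𝓝 (hilbertH b)) := by
  induction b with
  | zero => simp [hilbertH, altAddQuot, L_zero, zetaN_zero]
  | succ b ih =>
    have hid : ∀ M : ℕ,
        -∑ a ∈ Finset.range M, (-1 : ℝ) ^ a / (((a : ℝ) + 1) * (a - b))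
          + (-1) ^ M * H M * ((M : ℝ) - b)⁻¹
          - ∑ a ∈ Finset.range (M + 1), (-1 : ℝ) ^ a / ((a : ℝ) * (a + b))
          - (-1) ^ M * H M * ((M : ℝ) + (b + 1 : ℕ))⁻¹
          - ∑ a ∈ Finset.range (M + 1), (-1) ^ a * H a * (((a : ℝ) - b)⁻¹ - ((a : ℝ) + b)⁻¹)
        = ∑ a ∈ Finset.range (M + 1),
          (-1) ^ a * H a * (((a : ℝ) - (b + 1 : ℕ))⁻¹ - ((a : ℝ) + (b + 1 : ℕ))⁻¹) := by
      intro M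
      induction M with
      | zero => simp [H_zero]
      | succ M ih =>
        rw [Finset.sum_range_succ _ (M + 1), Finset.sum_range_succ _ (M + 1),
          Finset.sum_range_succ _ (M + 1), ← ih, Finset.sum_range_succ _ M, H_succ]
        push_cast
        rw [add_sub_add_right_eq_sub, show (M : ℝ) + 1 + b = M + (b + 1) by ring, pow_succ]
        simp only [div_eq_mul_inv, mul_inv]
        ring
    refine Tendsto.congr hid ?_
    have h := ((((tendsto_sum_alt_sub b).neg.add
      (tendsto_mul_inv_sub abs_sign_mul_H_le b)).sub
      ((tendsto_add_atTop_iff_nat 1).2 (hasSum_altAddQuot b).tendsto_sum_nat)).sub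
      (tendsto_mul_inv_add abs_sign_mul_H_le (b + 1))).sub ih
    convert h using 2
    rw [hilbertH, hilbertH, altAddQuot, if_neg (by omega), altAdd, altSub, L_succ 2, zetaN_succ]
    have h1 : (b : ℝ) + 1 ≠ 0 := by positivity
    have h4 := neg_one_pow_mul_self b
    rw [pow_succ (-1 : ℝ) b]
    push_cast
    field_simp
    linear_combination 2 * h4

/-- In the sum of the two kernels the `1 / a` parts of their partial fractions cancel, leaving the
difference evaluated by `hilbertH`. -/
theorem tsum_H_sub_add {b : ℕ} (hb : 1 ≤ b) :
    ∑' a : ℕ, (-1) ^ a * H a / ((a : ℝ) * (a - b)) + ∑' a : ℕ, (-1) ^ a * H a / ((a : ℝ) * (a + b))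
      = (hilbertH b + (-1) ^ b * H b / b) / b := by
  have hb' : (b : ℝ) ≠ 0 := by positivity
  have h1 := summable_fiber_sub SlowGrowth.H.sign_mul hb
  have h2 := summable_fiber_add SlowGrowth.H.sign_mul hb
  rw [← h1.tsum_add h2]
  refine HasSum.tsum_eq (hasSum_of_tendsto_range_succ (h1.add h2) ?_)
  refine (((tendsto_hilbertH b).add_const ((-1) ^ b * H b / b)).div_const (b : ℝ)).congr' ?_
  filter_upwards [eventually_ge_atTop b] with M hM
  have hp : ∀ a : ℕ, (-1) ^ a * H a / ((a : ℝ) * (a - b)) + (-1) ^ a * H a / ((a : ℝ) * (a + b))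
      = ((-1) ^ a * H a * (((a : ℝ) - b)⁻¹ - ((a : ℝ) + b)⁻¹)
        + if a = b then (-1) ^ b * H b / b else 0) / b := by
    intro a
    rcases Nat.eq_zero_or_pos a with rfl | ha
    · simp [H_zero, show 0 ≠ b by omega]
    have ha' : (a : ℝ) ≠ 0 := by positivity
    have hab : (a : ℝ) + b ≠ 0 := by positivity
    split_ifs with h
    · subst h
      simp only [sub_self, mul_zero, div_zero, inv_zero]
      field_simp
      ring
    · have : (a : ℝ) - b ≠ 0 := sub_ne_zero.2 (by exact_mod_cast h)
      field_simp
      ring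
  rw [Finset.sum_congr rfl fun a _ => hp a, ← Finset.sum_div, Finset.sum_add_distrib,
    Finset.sum_ite_eq' (Finset.range (M + 1)) b, if_pos (Finset.mem_range.2 (by omega))]

theorem hasSum_alt_div_add {b : ℕ} (hb : 1 ≤ b) :
    HasSum (fun a : ℕ => (-1 : ℝ) ^ a / a / ((a : ℝ) * (a + b)))
      ((-(zeta 2 / 2) - altAdd b / b) / b) := by
  have hb' : (b : ℝ) ≠ 0 := by positivity
  refine ((hasSum_alt_sq.sub (hasSum_alt_add hb)).div_const (b : ℝ)).congr_fun fun a => ?_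
  rcases Nat.eq_zero_or_pos a with rfl | ha
  · simp
  have ha' : (a : ℝ) ≠ 0 := by positivity
  have hab : (a : ℝ) + b ≠ 0 := by positivity
  field_simp
  ring

/-! ### The values in the relation as sums over `ℕ` -/

theorem hasSum_of_shift {f g : ℕ → ℝ} (hf : Summable f) (h0 : f 0 = 0)
    (hg : ∀ n, g n = f (n + 1)) : HasSum f (∑' n, g n) := by
  have : ∑' n, g n = ∑' n, f n := by
    rw [hf.tsum_eq_zero_add, h0, zero_add]
    exact tsum_congr hg
  rw [this]
  exact hf.hasSum

theorem abs_pow_le_one_of_sign {ε : ℝ} (hε : ε ∈ ({1, -1} : Set ℝ)) (n : ℕ) : |ε ^ n| ≤ 1 := by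
  rcases hε with rfl | rfl <;> simp

theorem slowGrowth_sign_mul_sum {ε₁ ε₂ : ℝ} (h₁ : ε₁ ∈ ({1, -1} : Set ℝ))
    (h₂ : ε₂ ∈ ({1, -1} : Set ℝ)) {r : ℕ} (hr : 1 ≤ r) :
    SlowGrowth fun n => ε₁ ^ n * ∑ k ∈ Finset.Icc 1 n, ε₂ ^ k / (k : ℝ) ^ r :=
  .bounded_mul (abs_pow_le_one_of_sign h₁)
    (.of_abs_le_H (abs_sum_div_pow_le_H (abs_pow_le_one_of_sign h₂) hr))

theorem zetaStarTerm_eq (ε₁ ε₂ : ℝ) (q r n : ℕ) : zetaStarTerm ε₁ ε₂ q r n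
    = ε₁ ^ (n + 1) * (∑ k ∈ Finset.Icc 1 (n + 1), ε₂ ^ k / (k : ℝ) ^ r) / ((n + 1 : ℕ) : ℝ) ^ q := by
  rw [zetaStarTerm, div_mul_eq_mul_div]
  push_cast
  rfl

theorem hasSum_zetaStar {ε₁ ε₂ : ℝ} (h₁ : ε₁ ∈ ({1, -1} : Set ℝ))
    (h₂ : ε₂ ∈ ({1, -1} : Set ℝ)) {q r : ℕ} (hq : 2 ≤ q) (hr : 1 ≤ r) :
    HasSum (fun n : ℕ => ε₁ ^ n * (∑ k ∈ Finset.Icc 1 n, ε₂ ^ k / (k : ℝ) ^ r) / (n : ℝ) ^ q)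
      (zetaStar ε₁ ε₂ q r) :=
  hasSum_of_shift (summable_div_pow (slowGrowth_sign_mul_sum h₁ h₂ hr) hq) (by simp)
    (zetaStarTerm_eq _ _ _ _)

theorem summable_zetaStarTerm {ε₁ ε₂ : ℝ} (h₁ : ε₁ ∈ ({1, -1} : Set ℝ))
    (h₂ : ε₂ ∈ ({1, -1} : Set ℝ)) {q r : ℕ} (hq : 2 ≤ q) (hr : 1 ≤ r) :
    Summable (zetaStarTerm ε₁ ε₂ q r) :=
  (((summable_nat_add_iff 1).2 (hasSum_zetaStar h₁ h₂ hq hr).summable)).congr fun n =>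
    (zetaStarTerm_eq _ _ _ _ n).symm

theorem sum_neg_one_pow_div (r n : ℕ) :
    ∑ k ∈ Finset.Icc 1 n, (-1 : ℝ) ^ k / (k : ℝ) ^ r = -L r n := by
  rw [L, ← Finset.sum_neg_distrib]
  refine Finset.sum_congr rfl fun k hk => ?_
  obtain ⟨m, rfl⟩ : ∃ m, k = m + 1 := ⟨k - 1, by have := (Finset.mem_Icc.1 hk).1; omega⟩
  rw [Nat.add_sub_cancel, pow_succ]
  ring

theorem hasSum_alt_zetaN {q r : ℕ} (hq : 2 ≤ q) (hr : 1 ≤ r) :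
    HasSum (fun n : ℕ => (-1) ^ n * zetaN r n / (n : ℝ) ^ q) (zetaStar (-1) 1 q r) := by
  simpa only [one_pow, zetaN] using hasSum_zetaStar (ε₁ := -1) (ε₂ := 1) (by simp) (by simp) hq hr

theorem hasSum_alt_H {q : ℕ} (hq : 2 ≤ q) :
    HasSum (fun n : ℕ => (-1) ^ n * H n / (n : ℝ) ^ q) (zetaStar (-1) 1 q 1) :=
  hasSum_alt_zetaN hq le_rfl

theorem hasSum_alt_L {q r : ℕ} (hq : 2 ≤ q) (hr : 1 ≤ r) :
    HasSum (fun n : ℕ => (-1) ^ n * L r n / (n : ℝ) ^ q) (-zetaStar (-1) (-1) q r) := by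
  refine (hasSum_zetaStar (ε₁ := -1) (ε₂ := -1) (by simp) (by simp) hq hr).neg.congr_fun fun n => ?_
  rw [sum_neg_one_pow_div]
  ring

theorem hasSum_L {q r : ℕ} (hq : 2 ≤ q) (hr : 1 ≤ r) :
    HasSum (fun n : ℕ => L r n / (n : ℝ) ^ q) (-zetaStar 1 (-1) q r) := by
  refine (hasSum_zetaStar (ε₁ := 1) (ε₂ := -1) (by simp) (by simp) hq hr).neg.congr_fun fun n => ?_
  rw [sum_neg_one_pow_div, one_pow, one_mul, neg_div, neg_neg]

theorem summable_alt_mul_self {c : ℕ → ℝ} (hc : SlowGrowth c) {q : ℕ} (hq : 2 ≤ q) :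
    Summable fun n : ℕ => (-1) ^ n * c n ^ 2 / (n : ℝ) ^ q :=
  (summable_mul_div_pow hc.sign_mul hc hq).congr fun n => by ring

theorem altLSqTerm_eq (q n : ℕ) :
    altLSqTerm q n = -((-1) ^ (n + 1) * L 1 (n + 1) ^ 2 / ((n + 1 : ℕ) : ℝ) ^ q) := by
  rw [altLSqTerm, pow_succ (-1 : ℝ)]
  push_cast
  ring

theorem altHSqTerm_eq (q n : ℕ) :
    altHSqTerm q n = -((-1) ^ (n + 1) * H (n + 1) ^ 2 / ((n + 1 : ℕ) : ℝ) ^ q) := by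
  rw [altHSqTerm, pow_succ (-1 : ℝ)]
  push_cast
  ring

theorem summable_altLSqTerm {q : ℕ} (hq : 2 ≤ q) : Summable (altLSqTerm q) :=
  ((summable_nat_add_iff 1).2 (summable_alt_mul_self (SlowGrowth.L le_rfl) hq).neg).congr fun n =>
    (altLSqTerm_eq q n).symm

theorem summable_altHSqTerm {q : ℕ} (hq : 2 ≤ q) : Summable (altHSqTerm q) :=
  ((summable_nat_add_iff 1).2 (summable_alt_mul_self SlowGrowth.H hq).neg).congr fun n =>
    (altHSqTerm_eq q n).symm

theorem hasSum_alt_L_sq {q : ℕ} (hq : 2 ≤ q) :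
    HasSum (fun n : ℕ => (-1) ^ n * L 1 n ^ 2 / (n : ℝ) ^ q) (-∑' n, altLSqTerm q n) := by
  have := (hasSum_of_shift (summable_alt_mul_self (SlowGrowth.L (r := 1) le_rfl) hq).neg
    (by simp [L_zero]) (altLSqTerm_eq q)).neg
  simpa using this

theorem hasSum_alt_H_sq {q : ℕ} (hq : 2 ≤ q) :
    HasSum (fun n : ℕ => (-1) ^ n * H n ^ 2 / (n : ℝ) ^ q) (-∑' n, altHSqTerm q n) := by
  have := (hasSum_of_shift (summable_alt_mul_self SlowGrowth.H hq).neg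
    (by simp [H_zero]) (altHSqTerm_eq q)).neg
  simpa using this

theorem hasSum_conditional_iff {f : ℕ → ℝ} {s : ℝ} :
    HasSum f s (SummationFilter.conditional ℕ)
      ↔ Tendsto (fun n => ∑ i ∈ Finset.range n, f i) atTop (𝓝 s) := by
  rw [HasSum, SummationFilter.conditional_filter_eq_map_range, tendsto_map'_iff]
  rfl

theorem sum_range_zetaBarTerm (s n : ℕ) : ∑ i ∈ Finset.range n, zetaBarTerm s i = L s n := by
  induction n with
  | zero => simp [L_zero]
  | succ n ih => rw [Finset.sum_range_succ, ih, L_succ, zetaBarTerm]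

theorem tendsto_L_zetaBar {s : ℕ} (hs : 1 ≤ s) :
    Summable (zetaBarTerm s) (SummationFilter.conditional ℕ) ∧
      Tendsto (L s) atTop (𝓝 (zetaBar s)) := by
  have hex : ∃ l, Tendsto (L s) atTop (𝓝 l) := by
    rcases hs.eq_or_lt with rfl | hs
    · exact ⟨_, tendsto_L_one⟩
    · have h := (summable_nat_add_iff 1).2
        (summable_bounded_div_pow (e := fun n => -(-1) ^ n) (by simp) (q := s) hs)
      refine ⟨_, h.hasSum.tendsto_sum_nat.congr fun n => ?_⟩
      rw [← sum_range_zetaBarTerm]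
      refine Finset.sum_congr rfl fun i _ => ?_
      rw [zetaBarTerm, pow_succ]
      push_cast
      ring
  obtain ⟨l, hl⟩ := hex
  have h : HasSum (zetaBarTerm s) l (SummationFilter.conditional ℕ) :=
    hasSum_conditional_iff.2 (hl.congr fun n => (sum_range_zetaBarTerm s n).symm)
  refine ⟨h.summable, ?_⟩
  rwa [zetaBar, h.tsum_eq]

theorem zetaBar_one : zetaBar 1 = Real.log 2 :=
  tendsto_nhds_unique (tendsto_L_zetaBar le_rfl).2 tendsto_L_one

theorem hasSum_alt_zetaBar {s : ℕ} (hs : 2 ≤ s) :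
    HasSum (fun n : ℕ => (-1) ^ n / (n : ℝ) ^ s) (-zetaBar s) := by
  have h := summable_bounded_div_pow abs_neg_one_pow_le hs
  refine hasSum_of_tendsto_range_succ h ?_
  refine (tendsto_L_zetaBar (by omega : 1 ≤ s)).2.neg.congr fun n => ?_
  rw [← sum_range_zetaBarTerm, ← Finset.sum_neg_distrib, Finset.sum_range_succ']
  have : s ≠ 0 := by omega
  simp only [CharP.cast_eq_zero, ne_eq, this, not_false_eq_true, zero_pow, div_zero, add_zero]
  refine Finset.sum_congr rfl fun i _ => ?_
  rw [zetaBarTerm, pow_succ]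
  push_cast
  ring

/-! ### The three relations -/

theorem pow_div_step {p : ℕ} (hp : 1 ≤ p) {c t : ℕ → ℝ} {u : ℕ → ℝ}
    (h : ∀ n : ℕ, 1 ≤ n → t n = u n / n) (n : ℕ) :
    c n / (n : ℝ) ^ p * t n = c n * u n / (n : ℝ) ^ (p + 1) := by
  rcases Nat.eq_zero_or_pos n with rfl | hn
  · simp [show p ≠ 0 by omega]
  · rw [h n hn, pow_succ]
    field_simp

theorem tsum_one_add {a : ℕ} (ha : 1 ≤ a) :
    ∑' b : ℕ, 1 / ((b : ℝ) * (a + b)) = H a / a := by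
  simpa only [add_comm] using (hasSum_one_add ha).tsum_eq

/-- `sum_mul_tsum_sub` for `L 1` and the alternating sign; the inner sums are `hasSum_L_sub` and
`hasSum_alt_sub`. -/
theorem sum_zetaStar_mul_zetaBar {p : ℕ} (hp : 1 ≤ p) :
    ∑ j ∈ Finset.Icc 2 p, zetaStar 1 (-1) j 1 * zetaBar (p + 2 - j)
      = -Real.log 2 * (zetaStar (-1) 1 (p + 1) 1 - zetaStar (-1) (-1) (p + 1) 1)
        - zetaStar (-1) (-1) (p + 1) 2 - zetaStar (-1) 1 (p + 1) 2 / 2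
        - 3 / 2 * ∑' n, altLSqTerm (p + 1) n
        - Real.log 2 * zetaStar 1 (-1) (p + 1) 1 + Real.log 2 * zetaStar (-1) (-1) (p + 1) 1
        - ((p : ℝ) + 1) * zetaStar (-1) (-1) (p + 2) 1 - zetaStar 1 (-1) (p + 2) 1 := by
  have hp1 : 2 ≤ p + 1 := by omega
  have hp2 : 2 ≤ p + 2 := by omega
  have h := sum_mul_tsum_sub (SlowGrowth.L (r := 1) le_rfl) abs_neg_one_pow_le hp
  have hB : ∑' b : ℕ, (-1) ^ b / (b : ℝ) ^ p * ∑' a : ℕ, L 1 a / ((a : ℝ) * (a - b))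
      = -Real.log 2 * (-zetaStar (-1) (-1) (p + 1) 1 + zetaStar (-1) 1 (p + 1) 1)
        + -zetaStar (-1) (-1) (p + 1) 2
        + (-∑' n, altLSqTerm (p + 1) n - zetaStar (-1) 1 (p + 1) 2) / 2
        + -zetaStar (-1) (-1) (p + 2) 1 := by
    refine HasSum.tsum_eq (HasSum.congr_fun (((((hasSum_alt_L hp1 le_rfl).add
      (hasSum_alt_H hp1)).mul_left (-Real.log 2)).add (hasSum_alt_L hp1 one_le_two)).add
      (((hasSum_alt_L_sq hp1).sub (hasSum_alt_zetaN hp1 one_le_two)).div_const 2) |>.add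
      (hasSum_alt_L hp2 le_rfl)) fun b => ?_)
    rw [pow_div_step hp fun b hb => (hasSum_L_sub hb).tsum_eq, hilbertL]
    ring
  have hA : ∑' a : ℕ, L 1 a / (a : ℝ) ^ p * ∑' b : ℕ, (-1) ^ b / ((b : ℝ) * (a - b))
      = -Real.log 2 * -zetaStar 1 (-1) (p + 1) 1 + Real.log 2 * -zetaStar (-1) (-1) (p + 1) 1
        - -∑' n, altLSqTerm (p + 1) n - -zetaStar (-1) (-1) (p + 2) 1
        - -zetaStar 1 (-1) (p + 2) 1 := by
    refine HasSum.tsum_eq (HasSum.congr_fun (((((hasSum_L hp1 le_rfl).mul_left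
      (-Real.log 2)).add ((hasSum_alt_L hp1 le_rfl).mul_left (Real.log 2))).sub
      (hasSum_alt_L_sq hp1)).sub (hasSum_alt_L hp2 le_rfl) |>.sub (hasSum_L hp2 le_rfl)) fun a => ?_)
    rw [pow_div_step hp fun a ha => (hasSum_alt_sub ha).tsum_eq, altSub]
    ring
  have hD : ∑' a : ℕ, L 1 a * (-1) ^ a / (a : ℝ) ^ (p + 2) = -zetaStar (-1) (-1) (p + 2) 1 := by
    simpa only [mul_comm] using (hasSum_alt_L hp2 le_rfl).tsum_eq
  rw [hB, hA, hD] at h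
  rw [Finset.sum_congr rfl fun j hj => show zetaStar 1 (-1) j 1 * zetaBar (p + 2 - j)
    = (∑' a : ℕ, L 1 a / (a : ℝ) ^ j) * ∑' b : ℕ, (-1) ^ b / (b : ℝ) ^ (p + 2 - j) by
      have hj := Finset.mem_Icc.1 hj
      rw [(hasSum_L (by omega) le_rfl).tsum_eq, (hasSum_alt_zetaBar (by omega)).tsum_eq, neg_mul_neg],
    h]
  ring

/-- The difference and sum forms are added because only the sum of their inner series over `a` is
evaluated, by `tsum_H_sub_add`. This produces the weight `1 + (-1) ^ j`, and the factor `1 - (-1) ^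
p` of the quadratic sum. -/
theorem sum_zetaStar_mul_zeta {p : ℕ} (hp : 1 ≤ p) :
    ∑ j ∈ Finset.Icc 2 p, (1 + (-1) ^ j) * (zetaStar (-1) 1 j 1 * zeta (p + 2 - j))
      = Real.log 2 * (zeta (p + 2) + zetaBar (p + 2)) - zetaStar (-1) (-1) (p + 2) 1
        + zeta 2 / 2 * zetaBar (p + 1) + zetaStar (-1) 1 (p + 1) 2 + zetaStar (-1) (-1) (p + 1) 2
        + ((p : ℝ) + 2) * zetaStar (-1) 1 (p + 2) 1
        + (1 - (-1) ^ p) * ∑' n, altHSqTerm (p + 1) n := by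
  have hp1 : 2 ≤ p + 1 := by omega
  have hp2 : 2 ≤ p + 2 := by omega
  have hc := SlowGrowth.H.sign_mul
  have he : ∀ n : ℕ, |(1 : ℝ)| ≤ 1 := by simp
  have h1 := sum_mul_tsum_sub hc he hp
  have h2 := sum_mul_tsum_add hc he hp
  have hB : ∑' b : ℕ, 1 / (b : ℝ) ^ p * ∑' a : ℕ, (-1) ^ a * H a / ((a : ℝ) * (a - b))
      + ∑' b : ℕ, 1 / (b : ℝ) ^ p * ∑' a : ℕ, (-1) ^ a * H a / ((a : ℝ) * (a + b))
      = Real.log 2 * zeta (p + 2) - Real.log 2 * -zetaBar (p + 2) + -zetaStar (-1) (-1) (p + 2) 1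
        + (-(zeta 2 / 2) * -zetaBar (p + 1) + zetaStar (-1) 1 (p + 1) 2
          - -zetaStar (-1) (-1) (p + 1) 2) + zetaStar (-1) 1 (p + 2) 1 := by
    rw [← (summable_left (k := fun x => (x.1 : ℝ) * (x.1 - x.2))
      (summable_sub_left hc he hp)).tsum_add (summable_left
      (k := fun x => (x.1 : ℝ) * (x.1 + x.2)) (summable_add_left hc he hp))]
    refine HasSum.tsum_eq (HasSum.congr_fun ((((hasSum_zeta hp2).mul_left (Real.log 2)).sub
      ((hasSum_alt_zetaBar hp2).mul_left (Real.log 2))).add (hasSum_alt_L hp2 le_rfl) |>.add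
      ((((hasSum_alt_zetaBar hp1).mul_left (-(zeta 2 / 2))).add (hasSum_alt_zetaN hp1 one_le_two)).sub
      (hasSum_alt_L hp1 one_le_two)) |>.add (hasSum_alt_H hp2)) fun b => ?_)
    simp only [← mul_add]
    rw [pow_div_step (c := fun _ => 1) hp fun b hb => tsum_H_sub_add hb, hilbertH]
    rcases Nat.eq_zero_or_pos b with rfl | hb
    · simp
    · rw [altAddQuot, if_neg hb.ne', altAdd]
      ring
  have hA : ∑' a : ℕ, (-1) ^ a * H a / (a : ℝ) ^ p * ∑' b : ℕ, 1 / ((b : ℝ) * (a - b))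
      = -∑' n, altHSqTerm (p + 1) n - 2 * zetaStar (-1) 1 (p + 2) 1 := by
    refine HasSum.tsum_eq (HasSum.congr_fun ((hasSum_alt_H_sq hp1).sub
      ((hasSum_alt_H hp2).mul_left 2)) fun a => ?_)
    rw [pow_div_step (c := fun n => (-1) ^ n * H n) hp fun a ha => (hasSum_one_sub ha).tsum_eq]
    ring
  have hA' : ∑' a : ℕ, (-1) ^ a * H a / (a : ℝ) ^ p * ∑' b : ℕ, 1 / ((b : ℝ) * (a + b))
      = -∑' n, altHSqTerm (p + 1) n := by
    refine HasSum.tsum_eq (HasSum.congr_fun (hasSum_alt_H_sq hp1) fun a => ?_)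
    rw [pow_div_step (c := fun n => (-1) ^ n * H n) hp fun a ha => tsum_one_add ha]
    ring
  have hD : ∑' a : ℕ, (-1) ^ a * H a * 1 / (a : ℝ) ^ (p + 2) = zetaStar (-1) 1 (p + 2) 1 := by
    simpa only [mul_one] using (hasSum_alt_H hp2).tsum_eq
  rw [hA, hD] at h1
  rw [hA'] at h2
  have hj : ∀ j ∈ Finset.Icc 2 p, (∑' a : ℕ, (-1) ^ a * H a / (a : ℝ) ^ j)
      * ∑' b : ℕ, 1 / (b : ℝ) ^ (p + 2 - j) = zetaStar (-1) 1 j 1 * zeta (p + 2 - j) := fun j hj => by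
    have hj := Finset.mem_Icc.1 hj
    rw [(hasSum_alt_H (by omega)).tsum_eq, (hasSum_zeta (by omega)).tsum_eq]
  rw [Finset.sum_congr rfl hj] at h1
  rw [Finset.sum_congr rfl fun j h => by rw [hj j h]] at h2
  simp only [add_mul, one_mul, Finset.sum_add_distrib] at h1 h2 ⊢
  linear_combination h1 + h2 + hB

/-- `sum_mul_tsum_add` for `(-1) ^ a / a` and 1: the extra `1 / a` raises the exponent `j` to `j +
1`. -/
theorem sum_zetaBar_mul_zeta {p : ℕ} (hp : 1 ≤ p) :
    ∑ j ∈ Finset.Icc 2 p, (-1) ^ j * (zeta (p + 2 - j) * zetaBar (j + 1))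
      = zeta 2 / 2 * zeta (p + 1) - Real.log 2 * (zeta (p + 2) + zetaBar (p + 2))
        + zetaStar (-1) (-1) (p + 2) 1 - (-1) ^ p * zetaStar (-1) 1 (p + 2) 1 := by
  have hp1 : 2 ≤ p + 1 := by omega
  have hp2 : 2 ≤ p + 2 := by omega
  have hc : SlowGrowth fun n : ℕ => (-1 : ℝ) ^ n / n := by
    convert slowGrowth_one_of_pos.bounded_mul (e := fun n : ℕ => (-1 : ℝ) ^ n / n) (fun n => ?_)
      using 2 with n
    · rcases Nat.eq_zero_or_pos n with rfl | hn
      · simp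
      · simp [hn.ne']
    · simpa [abs_div] using Nat.cast_inv_le_one n
  have h := sum_mul_tsum_add hc (e := fun _ => 1) (by simp) hp
  have hB : ∑' b : ℕ, 1 / (b : ℝ) ^ p * ∑' a : ℕ, (-1) ^ a / (a : ℝ) / ((a : ℝ) * (a + b))
      = -(zeta 2 / 2) * zeta (p + 1) + Real.log 2 * zeta (p + 2) - Real.log 2 * -zetaBar (p + 2)
        + -zetaStar (-1) (-1) (p + 2) 1 := by
    refine HasSum.tsum_eq (HasSum.congr_fun ((((hasSum_zeta hp1).mul_left (-(zeta 2 / 2))).add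
      ((hasSum_zeta hp2).mul_left (Real.log 2))).sub ((hasSum_alt_zetaBar hp2).mul_left
      (Real.log 2)) |>.add (hasSum_alt_L hp2 le_rfl)) fun b => ?_)
    rw [pow_div_step (c := fun _ => 1) hp fun b hb => (hasSum_alt_div_add hb).tsum_eq, altAdd]
    ring
  have hA : ∑' a : ℕ, (-1) ^ a / (a : ℝ) / (a : ℝ) ^ p * ∑' b : ℕ, 1 / ((b : ℝ) * (a + b))
      = zetaStar (-1) 1 (p + 2) 1 := by
    refine HasSum.tsum_eq (HasSum.congr_fun (hasSum_alt_H hp2) fun a => ?_)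
    rw [pow_div_step (c := fun n => (-1) ^ n / (n : ℝ)) hp fun a ha => tsum_one_add ha]
    ring
  rw [hB, hA] at h
  rw [Finset.sum_congr rfl fun j hj => show (-1) ^ j * (zeta (p + 2 - j) * zetaBar (j + 1))
    = -((-1) ^ j * ((∑' a : ℕ, (-1) ^ a / (a : ℝ) / (a : ℝ) ^ j)
      * ∑' b : ℕ, 1 / (b : ℝ) ^ (p + 2 - j))) by
      have hj := Finset.mem_Icc.1 hj
      have ha := hasSum_alt_zetaBar (s := j + 1) (by omega)
      simp only [pow_succ' _ j, ← div_div] at ha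
      rw [ha.tsum_eq, (hasSum_zeta (by omega)).tsum_eq]
      ring, Finset.sum_neg_distrib, h]
  ring

end EulerSum

theorem sum_Icc_two_eq_sum_Icc_one (f : ℕ → ℝ) (p : ℕ) :
    ∑ j ∈ Finset.Icc 2 p, f j = ∑ i ∈ Finset.Icc 1 (p - 1), f (i + 1) := by
  refine Finset.sum_nbij' (fun j => j - 1) (fun i => i + 1) ?_ ?_ ?_ ?_ ?_ <;>
    intro j hj <;> simp only [Finset.mem_Icc] at hj ⊢
  · omega
  · omega
  · omega
  · omega
  · rw [Nat.sub_add_cancel (by omega)]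

open EulerSum in
theorem theorem3p2 (p : ℕ) (hp : 1 ≤ p) :
    -- convergence of the quadratic, alternating zeta and double series
    Summable (altLSqTerm (p + 1)) ∧
    Summable (altHSqTerm (p + 1)) ∧
    (∀ s : ℕ, 1 ≤ s → Summable (zetaBarTerm s) (SummationFilter.conditional ℕ)) ∧
    (∀ ε₁ ∈ ({1, -1} : Set ℝ), ∀ ε₂ ∈ ({1, -1} : Set ℝ), ∀ q r : ℕ, 2 ≤ q → 1 ≤ r →
      Summable (zetaStarTerm ε₁ ε₂ q r)) ∧
    -- the relation
    3 / 2 * ∑' n : ℕ, altLSqTerm (p + 1) n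
        - (1 + (-1 : ℝ) ^ (p - 1)) * ∑' n : ℕ, altHSqTerm (p + 1) n
      = Real.log 2 * (zetaStar (-1) (-1) (p + 1) 1 - zetaStar (-1) 1 (p + 1) 1)
        + 1 / 2 * zeta 2 * (zeta (p + 1) + zetaBar (p + 1))
        + 1 / 2 * zetaStar (-1) 1 (p + 1) 2
        - ∑ j ∈ Finset.Icc 2 p,
            (1 - (-1 : ℝ) ^ (j - 1)) * zetaStar (-1) 1 j 1 * zeta (p + 2 - j)
        - ∑ j ∈ Finset.Icc 2 (p + 1), zetaStar 1 (-1) j 1 * zetaBar (p + 2 - j)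
        + ((p : ℝ) + 2 + (-1 : ℝ) ^ (p - 1)) * zetaStar (-1) 1 (p + 2) 1
        - zetaStar 1 (-1) (p + 2) 1
        - ∑ i ∈ Finset.Icc 1 (p - 1),
            (-1 : ℝ) ^ (i - 1) * zeta (p + 1 - i) * zetaBar (i + 2)
        - ((p : ℝ) + 1) * zetaStar (-1) (-1) (p + 2) 1
        + Real.log 2 * zetaStar (-1) (-1) (p + 1) 1 := by

  have hp1 : 2 ≤ p + 1 := by omega
  refine ⟨summable_altLSqTerm hp1, summable_altHSqTerm hp1, fun s hs => (tendsto_L_zetaBar hs).1,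
    fun ε₁ h₁ ε₂ h₂ q r hq hr => summable_zetaStarTerm h₁ h₂ hq hr, ?_⟩
  have hsgn : (-1 : ℝ) ^ (p - 1) = -(-1) ^ p := by
    obtain ⟨m, rfl⟩ : ∃ m, p = m + 1 := ⟨p - 1, by omega⟩
    rw [Nat.add_sub_cancel, pow_succ]
    ring
  have h₁ : ∑ j ∈ Finset.Icc 2 p, (1 - (-1 : ℝ) ^ (j - 1)) * zetaStar (-1) 1 j 1 * zeta (p + 2 - j)
      = ∑ j ∈ Finset.Icc 2 p, (1 + (-1) ^ j) * (zetaStar (-1) 1 j 1 * zeta (p + 2 - j)) := by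
    refine Finset.sum_congr rfl fun j hj => ?_
    obtain ⟨m, rfl⟩ : ∃ m, j = m + 1 := ⟨j - 1, by have := (Finset.mem_Icc.1 hj).1; omega⟩
    rw [Nat.add_sub_cancel, pow_succ]
    ring
  have h₂ : ∑ i ∈ Finset.Icc 1 (p - 1), (-1 : ℝ) ^ (i - 1) * zeta (p + 1 - i) * zetaBar (i + 2)
      = ∑ j ∈ Finset.Icc 2 p, (-1) ^ j * (zeta (p + 2 - j) * zetaBar (j + 1)) := by
    rw [sum_Icc_two_eq_sum_Icc_one]
    refine Finset.sum_congr rfl fun i hi => ?_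
    obtain ⟨m, rfl⟩ : ∃ m, i = m + 1 := ⟨i - 1, by have := (Finset.mem_Icc.1 hi).1; omega⟩
    rw [Nat.add_sub_cancel, pow_succ, pow_succ, show p + 1 - (m + 1) = p + 2 - (m + 1 + 1) by omega]
    ring
  -- The term `j = p + 1` contains the conditionally convergent `zetaBar 1 = log 2`, hence lies
  -- outside the product formula; it cancels `-log 2 * zetaStar 1 (-1) (p + 1) 1` there.
  rw [h₁, h₂, Finset.sum_Icc_succ_top (by omega), show p + 2 - (p + 1) = 1 by omega, zetaBar_one,
    sum_zetaStar_mul_zetaBar hp, sum_zetaStar_mul_zeta hp, sum_zetaBar_mul_zeta hp, hsgn]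
  ring
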